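/- Define $\log^{(1)}t=\log t$ for $t>1$ and $\log^{(1)}t=0$ otherwise, and $\log^{(i)}t=\log^{(1)}(\log^{(i-1)}t)$ for $i\ge 2$. Let $n\ge 2$ be an integer, let $a_2,\dots,a_n\ge 0$ be real numbers, not all zero, and let $$\lambda(t)=\frac{1}{|t|\log 2}\sum_{i=2}^n a_i\log^{(i)}|t|,\qquad t\in\mathbb R\setminus\{0\}.$$ Let $\Pi$ be a Poisson point process on $\mathbb R$ with mean measure $\lambda(t)\,dt$. The greedy walk on $\Pi$ starts at $S_0=0$ and always moves to the nearest not yet visited point: with $\Pi_0=\Pi$, for all $k\ge 0$, $S_{k+1}$ is a point of $\Pi_k$ at minimal distance from $S_k$, and $\Pi_{k+1}=\Pi_k\setminus\{S_{k+1}\}$. The walk is called recurrent if $\operatorname{sign}(S_{k+1})\ne\operatorname{sign}(S_k)$ for infinitely many $k$, and transient otherwise. Then, almost surely, the greedy walk on $\Pi$ is well defined (a nearest unvisited point always exists), and the following holds however ties are broken. The walk is transient with probability $1$ if - $a_2>1$, or - $n\ge 3$, $a_2=1$ and $a_3>2$, or - $n\ge 4$, $a_2=1$, $a_3=2$, and there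 exists $m$ with $3\le m\le n-1$ such that $a_i=1$ for all $4\le i\le m$ and $a_{m+1}>1$ (for $m=3$ this just says $a_4>1$). Otherwise, the walk is recurrent with probability $1$. -/

import Mathlib

open MeasureTheory ProbabilityTheory Filter
open scoped ENNReal NNReal

namespace GreedyWalk

/-- The number of points (in `ℕ∞`) of the configuration `X ω` in the set `A`. -/
noncomputable def count {Ω : Type*} (X : Ω → Set ℝ) (A : Set ℝ) (ω : Ω) : ℕ∞ :=
  (X ω ∩ A).encard

/-- `X` is a Poisson point process on `ℝ` with mean measure `μ`, seen as a random set of points: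
the numbers of points in Borel sets are random variables, the numbers of points in finitely many
pairwise disjoint Borel sets are independent, and the number of points in a Borel set `A` has the
Poisson distribution with parameter `μ A` (it is almost surely infinite if `μ A = ∞`). -/
structure IsPoissonProcess {Ω : Type*} [MeasurableSpace Ω] (P : Measure Ω)
    (X : Ω → Set ℝ) (μ : Measure ℝ) : Prop where
  measurable_count : ∀ A : Set ℝ, MeasurableSet A → Measurable (count X A)
  indep : ∀ (k : ℕ) (A : Fin k → Set ℝ), (∀ i, MeasurableSet (A i)) →
    (∀ i j, i ≠ j → Disjoint (A i) (A j)) → iIndepFun (fun i => count X (A i)) P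
  law : ∀ A : Set ℝ, MeasurableSet A → μ A ≠ ∞ → ∀ k : ℕ,
    P {ω | count X A ω = (k : ℕ∞)} = poissonMeasure (μ A).toNNReal {k}
  law_top : ∀ A : Set ℝ, MeasurableSet A → μ A = ∞ → ∀ᵐ ω ∂P, count X A ω = ⊤

/-- The points of `X` that have not been visited by `S` at the times `1, …, n`. -/
def unvisited (X : Set ℝ) (S : ℕ → ℝ) : ℕ → Set ℝ
  | 0 => X
  | n + 1 => unvisited X S n \ {S (n + 1)}

/-- `S` is a greedy walk on `X` started at `0`: it always moves to a nearest unvisited point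
(ties may be broken in any way). -/
def IsGreedyWalk (X : Set ℝ) (S : ℕ → ℝ) : Prop :=
  S 0 = 0 ∧ ∀ n, S (n + 1) ∈ unvisited X S n ∧
    ∀ x ∈ unvisited X S n, dist (S n) (S (n + 1)) ≤ dist (S n) x

/-- The walk `S` jumps over `0` infinitely often. -/
def JumpsInfinitelyOften (S : ℕ → ℝ) : Prop :=
  ∃ᶠ n in atTop, SignType.sign (S (n + 1)) ≠ SignType.sign (S n)

/-- The greedy walk on `X` is well defined and recurrent (however ties are broken). -/
def Recurrent (X : Set ℝ) : Prop :=
  (∃ S, IsGreedyWalk X S) ∧ ∀ S, IsGreedyWalk X S → JumpsInfinitelyOften S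

/-- The greedy walk on `X` is well defined and transient (however ties are broken). -/
def Transient (X : Set ℝ) : Prop :=
  (∃ S, IsGreedyWalk X S) ∧ ∀ S, IsGreedyWalk X S → ¬ JumpsInfinitelyOften S

/-- The logarithm, truncated to be `0` on `(-∞, 1]`. -/
noncomputable def truncLog (t : ℝ) : ℝ := if 1 < t then Real.log t else 0

/-- The iterated logarithm: `iterLog 1 = truncLog` and `iterLog n t = truncLog (iterLog (n-1) t)`
for `n ≥ 2` (with `iterLog 0 t = t`). -/
noncomputable def iterLog : ℕ → ℝ → ℝ
  | 0, t => t
  | n + 1, t => truncLog (iterLog n t)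

/-- The intensity `λ(t) = (|t| log 2)⁻¹ ∑_{i=2}^n a_i log^{(i)} |t|`. -/
noncomputable def intensity (n : ℕ) (a : ℕ → ℝ) (t : ℝ) : ℝ :=
  1 / (|t| * Real.log 2) * ∑ i ∈ Finset.Icc 2 n, a i * iterLog i |t|

/-- The measure on `ℝ` with density `t ↦ l t` with respect to Lebesgue measure (for `l ≥ 0`). -/
noncomputable def meanMeasure (l : ℝ → ℝ) : Measure ℝ :=
  volume.withDensity (fun t => ENNReal.ofReal (l t))

/-- The transience region for the coefficients `a_2, …, a_n`. -/
def TransienceCondition (n : ℕ) (a : ℕ → ℝ) : Prop :=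
  1 < a 2 ∨
  (3 ≤ n ∧ a 2 = 1 ∧ 2 < a 3) ∨
  (3 ≤ n ∧ a 2 = 1 ∧ a 3 = 2 ∧
    ∃ m, 3 ≤ m ∧ m + 1 ≤ n ∧ (∀ i, 4 ≤ i → i ≤ m → a i = 1) ∧ 1 < a (m + 1))

end GreedyWalk

/-! Once at a positive point x, the walk sits at the rightmost visited point
(`IsGreedyWalk.lt_or_gt`), so it either continues to the next point on the right or crosses to an
unvisited point -y on the left, at distance x + y. If every far point x is followed by another one
in (x, 2x], crossing is never a nearest move and the walk is transient (`transient_of_close`).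
Suppose instead that for every R there are arbitrarily far points x with (x, 2x + R] empty. A walk
that stays on the positive side forever leaves some -y unvisited, and at such an x with R ≥ y the
point -y is nearer than anything on the right; so the walk is recurrent (`recurrent_of_gaps`). The
other side follows by reflection.

For t in [2^b, 2^(b+1)] the mean number of points in (t, 2t] is g(b) + O(1), where g = `rate n a`
(`dyadicGrowth_intensity`). A dyadic block therefore holds about g(b) cells of unit mass, and each
of them contains a point followed by a gap with probability of order exp(-g(b)). If ∑ g exp(-g)
converges, the first Borel-Cantelli lemma excludes far gaps (`DyadicGrowth.ae_close`). If it
diverges, the gap events are pairwise disjoint or independent, hence negatively correlated, and a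
second moment argument produces infinitely many (`DyadicGrowth.ae_gaps`).

It remains to decide convergence (`summable_rate_iff`). When a_2 = 1, g is comparable to log b, so
the factor g lowers the coefficient of log log b in the exponent by one; this is why the threshold
for a_3 is 2. The first corrected coefficient different from 1 then decides, by comparison with
Bertrand series. -/

namespace GreedyWalk

/-! ### Greedy walks on a fixed configuration -/

section Deterministic

variable {X : Set ℝ} {S : ℕ → ℝ}

lemma mem_unvisited {n : ℕ} {z : ℝ} :
    z ∈ unvisited X S n ↔ z ∈ X ∧ ∀ i, 1 ≤ i → i ≤ n → z ≠ S i := by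
  induction n with
  | zero => simp only [unvisited]; exact ⟨fun h => ⟨h, fun i _ _ => by omega⟩, fun h => h.1⟩
  | succ n ih =>
    simp only [unvisited, Set.mem_sdiff, ih, Set.mem_singleton_iff]
    constructor
    · rintro ⟨⟨h1, h2⟩, h3⟩
      refine ⟨h1, fun i hi hin => ?_⟩
      rcases Nat.lt_or_ge n i with h | h
      · obtain rfl : i = n + 1 := by omega
        exact h3
      · exact h2 i hi h
    · rintro ⟨h1, h2⟩
      exact ⟨⟨h1, fun i hi hin => h2 i hi (by omega)⟩, h2 _ (by omega) le_rfl⟩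

lemma IsGreedyWalk.mem (h : IsGreedyWalk X S) {n : ℕ} (hn : 1 ≤ n) : S n ∈ X := by
  obtain ⟨m, rfl⟩ : ∃ m, n = m + 1 := ⟨n - 1, by omega⟩
  exact (mem_unvisited.1 (h.2 m).1).1

lemma IsGreedyWalk.ne (h : IsGreedyWalk X S) {i j : ℕ} (hi : 1 ≤ i) (hij : i < j) :
    S j ≠ S i := by
  obtain ⟨m, rfl⟩ : ∃ m, j = m + 1 := ⟨j - 1, by omega⟩
  exact (mem_unvisited.1 (h.2 m).1).2 i hi (by omega)

/-- The visited points form an interval of the configuration. -/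
lemma IsGreedyWalk.lt_or_gt (h : IsGreedyWalk X S) (h0 : (0 : ℝ) ∉ X) (n : ℕ) :
    ∀ z ∈ unvisited X S n, (∀ i ≤ n, S i < z) ∨ (∀ i ≤ n, z < S i) := by
  induction n with
  | zero =>
    intro z hz
    have hz0 : z ≠ 0 := fun h' => h0 (h' ▸ hz)
    rcases lt_or_gt_of_ne hz0 with h' | h'
    · right; intro i hi; obtain rfl : i = 0 := by omega
      rw [h.1]; exact h'
    · left; intro i hi; obtain rfl : i = 0 := by omega
      rw [h.1]; exact h'
  | succ n ih =>
    intro z hz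
    have hzn : z ∈ unvisited X S n := hz.1
    have hne : z ≠ S (n + 1) := hz.2
    have hd := (h.2 n).2 z hzn
    rw [Real.dist_eq, Real.dist_eq] at hd
    rcases ih z hzn with hz' | hz' <;> rcases ih _ (h.2 n).1 with hs | hs
    · left
      have h1 := hz' n le_rfl
      have h2 := hs n le_rfl
      rw [abs_of_neg (by linarith), abs_of_neg (by linarith)] at hd
      intro i hi
      rcases Nat.lt_or_ge n i with hi' | hi'
      · obtain rfl : i = n + 1 := by omega
        exact lt_of_le_of_ne (by linarith) hne.symm
      · exact hz' i hi'
    · left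
      intro i hi
      rcases Nat.lt_or_ge n i with hi' | hi'
      · obtain rfl : i = n + 1 := by omega
        exact (hs n le_rfl).trans (hz' n le_rfl)
      · exact hz' i hi'
    · right
      intro i hi
      rcases Nat.lt_or_ge n i with hi' | hi'
      · obtain rfl : i = n + 1 := by omega
        exact (hz' n le_rfl).trans (hs n le_rfl)
      · exact hz' i hi'
    · right
      have h1 := hz' n le_rfl
      have h2 := hs n le_rfl
      rw [abs_of_pos (by linarith), abs_of_pos (by linarith)] at hd
      intro i hi
      rcases Nat.lt_or_ge n i with hi' | hi'
      · obtain rfl : i = n + 1 := by omega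
        exact lt_of_le_of_ne (by linarith) hne
      · exact hz' i hi'

lemma IsGreedyWalk.gt_of_pos (h : IsGreedyWalk X S) (h0 : (0 : ℝ) ∉ X) {n : ℕ}
    {z : ℝ} (hz : z ∈ unvisited X S n) (hpos : 0 < z) : ∀ i ≤ n, S i < z := by
  rcases h.lt_or_gt h0 n z hz with h' | h'
  · exact h'
  · have := h' 0 (Nat.zero_le _)
    rw [h.1] at this
    linarith

lemma mem_unvisited_neg {n : ℕ} {z : ℝ} :
    z ∈ unvisited (-X) (-S) n ↔ -z ∈ unvisited X S n := by
  simp [mem_unvisited, neg_eq_iff_eq_neg]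

lemma IsGreedyWalk.neg (h : IsGreedyWalk X S) : IsGreedyWalk (-X) (-S) := by
  refine ⟨by simp [h.1], fun n => ⟨?_, fun x hx => ?_⟩⟩
  · rw [mem_unvisited_neg]; simpa using (h.2 n).1
  · rw [mem_unvisited_neg] at hx
    have := (h.2 n).2 _ hx
    rw [Pi.neg_apply, Pi.neg_apply, dist_neg_neg]
    rwa [← dist_neg_neg (S n) (-x), neg_neg] at this

/-- Bounded parts of the configuration are finite. -/
def LocFinite (X : Set ℝ) : Prop := ∀ M : ℝ, (X ∩ Set.Icc (-M) M).Finite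

lemma LocFinite.neg (hX : LocFinite X) : LocFinite (-X) := by
  intro M
  have : -X ∩ Set.Icc (-M) M = -(X ∩ Set.Icc (-M) M) := by
    ext x; simp only [Set.mem_inter_iff, Set.mem_neg, Set.mem_Icc]
    constructor <;> rintro ⟨h1, h2, h3⟩ <;> exact ⟨h1, by linarith, by linarith⟩
  rw [this]
  exact (hX M).neg

/-- Only points at most as far from `p` as a given `x0` compete, and local finiteness makes these
finitely many. -/
lemma LocFinite.exists_nearest (hX : LocFinite X) (hne : X.Nonempty) (p : ℝ) :
    ∃ x ∈ X, ∀ y ∈ X, dist p x ≤ dist p y := by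
  obtain ⟨x0, hx0⟩ := hne
  set F := X ∩ Set.Icc (-(|p| + dist p x0)) (|p| + dist p x0) with hF
  have key : ∀ y ∈ X, dist p y ≤ dist p x0 → y ∈ F := by
    intro y hy hd
    refine ⟨hy, abs_le.1 ?_⟩
    have : |y| ≤ |p| + |p - y| := by
      have := abs_sub_abs_le_abs_sub y p
      rw [abs_sub_comm y p] at this; linarith
    rw [Real.dist_eq p y] at hd
    linarith
  obtain ⟨x, hx, hmin⟩ := (hX _).exists_minimalFor (fun y => dist p y) F ⟨x0, key x0 hx0 le_rfl⟩
  refine ⟨x, hx.1, fun y hy => ?_⟩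
  by_contra! hlt
  by_cases hyF : y ∈ F
  · exact absurd (hmin hyF hlt.le) (not_le.2 hlt)
  · have h1 : dist p x0 < dist p y := by
      by_contra! h'
      exact hyF (key y hy h')
    have h2 : dist p x0 ≤ dist p x := by linarith
    have := hmin (key x0 hx0 le_rfl) h2
    simp only at this
    linarith

lemma exists_greedyWalk (hX : LocFinite X) (hinf : X.Infinite) : ∃ S, IsGreedyWalk X S := by
  classical
  have hloc : ∀ Y ⊆ X, LocFinite Y := fun Y hY M =>
    (hX M).subset (Set.inter_subset_inter_left _ hY)
  have hex : ∀ (p : ℝ) (Y : Set ℝ), ∃ x, Y ⊆ X → Y.Infinite →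
      x ∈ Y ∧ ∀ y ∈ Y, dist p x ≤ dist p y := by
    intro p Y
    by_cases h : Y ⊆ X ∧ Y.Infinite
    · obtain ⟨x, hx⟩ := (hloc Y h.1).exists_nearest h.2.nonempty p
      exact ⟨x, fun _ _ => hx⟩
    · exact ⟨0, fun h1 h2 => absurd ⟨h1, h2⟩ h⟩
  choose nxt hnxt using hex
  -- The state carries the current position together with the set of points still unvisited.
  let st : ℕ → ℝ × Set ℝ := fun n =>
    Nat.rec ((0 : ℝ), X) (fun _ q => (nxt q.1 q.2, q.2 \ {nxt q.1 q.2})) n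
  let S : ℕ → ℝ := fun n => (st n).1
  have hS : ∀ n, S (n + 1) = nxt (S n) (st n).2 := fun n => rfl
  have hU : ∀ n, (st n).2 = unvisited X S n := by
    intro n
    induction n with
    | zero => rfl
    | succ n ih =>
      change (st n).2 \ {nxt (st n).1 (st n).2} = unvisited X S n \ {S (n + 1)}
      rw [ih, hS, ih]
  have hsub : ∀ n, unvisited X S n ⊆ X := fun n z hz => (mem_unvisited.1 hz).1
  have hI : ∀ n, (unvisited X S n).Infinite := by
    intro n
    induction n with
    | zero => exact hinf
    | succ n ih => exact ih.sdiff (Set.finite_singleton _)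
  refine ⟨S, rfl, fun n => ?_⟩
  rw [hS, hU]
  exact hnxt (S n) _ (hsub n) (hI n)

/-- No point is visited twice, and a bounded region contains finitely many. -/
lemma IsGreedyWalk.eventually_abs_gt (h : IsGreedyWalk X S) (hX : LocFinite X) (T : ℝ) :
    ∀ᶠ n in atTop, T < |S n| := by
  have hinj : Set.InjOn S {n | 1 ≤ n ∧ |S n| ≤ T} := by
    intro i hi j hj hij
    rcases lt_trichotomy i j with h' | h' | h'
    · exact absurd hij.symm (h.ne hi.1 h')
    · exact h'
    · exact absurd hij (h.ne hj.1 h')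
  have hfin : {n | 1 ≤ n ∧ |S n| ≤ T}.Finite := by
    refine Set.Finite.of_finite_image ((hX T).subset ?_) hinj
    rintro _ ⟨n, hn, rfl⟩
    exact ⟨h.mem hn.1, abs_le.1 hn.2⟩
  obtain ⟨N, hN⟩ := hfin.bddAbove
  filter_upwards [eventually_gt_atTop N, eventually_ge_atTop 1] with n hn h1
  by_contra! hle
  exact absurd (hN (show n ∈ {n | 1 ≤ n ∧ |S n| ≤ T} from ⟨h1, hle⟩)) (by omega)

/-- The point to the right of x = `S n` is unvisited and at distance at most x, whereas any negative
point is at distance more than x. -/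
lemma IsGreedyWalk.not_jump_of_pos (h : IsGreedyWalk X S) (h0 : (0 : ℝ) ∉ X) {T : ℝ}
    (hT : ∀ x ∈ X, T < x → (X ∩ Set.Ioc x (2 * x)).Nonempty) {n : ℕ} (hn : 1 ≤ n)
    (hpos : 0 < S n) (hTn : T < S n) : 0 < S (n + 1) := by
  by_contra! hneg
  obtain ⟨z, hzX, hz1, hz2⟩ := hT _ (h.mem hn) hTn
  have hlt : S (n + 1) < 0 :=
    lt_of_le_of_ne hneg fun h' => h0 (h' ▸ h.mem (Nat.le_add_left 1 n))
  obtain ⟨m, rfl⟩ : ∃ m, n = m + 1 := ⟨n - 1, by omega⟩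
  have hmax := h.gt_of_pos h0 (h.2 m).1 hpos
  have hzu : z ∈ unvisited X S (m + 1) := by
    refine mem_unvisited.2 ⟨hzX, fun i _ hi hzi => ?_⟩
    rcases Nat.lt_or_ge m i with hi' | hi'
    · obtain rfl : i = m + 1 := by omega
      linarith
    · have := hmax i hi'
      linarith
  have hd := (h.2 (m + 1)).2 z hzu
  rw [Real.dist_eq, Real.dist_eq, abs_of_pos (by linarith), abs_of_neg (by linarith)] at hd
  linarith

/-- If every far away point has another point within the doubled distance, the walk is
transient. -/
lemma transient_of_close (hX : LocFinite X) (hinf : X.Infinite) (h0 : (0 : ℝ) ∉ X)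
    (hpos : ∃ T, ∀ x ∈ X, T < x → (X ∩ Set.Ioc x (2 * x)).Nonempty)
    (hneg : ∃ T, ∀ x ∈ -X, T < x → (-X ∩ Set.Ioc x (2 * x)).Nonempty) : Transient X := by
  refine ⟨exists_greedyWalk hX hinf, fun S hS => ?_⟩
  obtain ⟨T, hT⟩ := hpos
  obtain ⟨T', hT'⟩ := hneg
  rw [JumpsInfinitelyOften, not_frequently]
  filter_upwards [hS.eventually_abs_gt hX T, hS.eventually_abs_gt hX T',
    hS.eventually_abs_gt hX 0, eventually_ge_atTop 1] with n h1 h2 h3 h4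
  rw [not_not]
  rcases lt_or_gt_of_ne (abs_pos.1 h3) with hs | hs
  · rw [abs_of_neg hs] at h1 h2
    have := hS.neg.not_jump_of_pos (by simpa using h0) hT' h4 (by simpa using hs) h2
    rw [Pi.neg_apply] at this
    rw [sign_neg hs, sign_neg (by linarith)]
  · rw [abs_of_pos hs] at h1 h2
    have := hS.not_jump_of_pos h0 hT h4 hs h1
    rw [sign_pos hs, sign_pos this]

/-- A walk that stays positive must land on the left end `x` of a long gap, and from there an
abandoned negative point is closer than the far side of the gap. -/
lemma IsGreedyWalk.false_of_eventually_pos (h : IsGreedyWalk X S) (hX : LocFinite X)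
    (h0 : (0 : ℝ) ∉ X)
    (hpos : ∀ R : ℕ, ∀ T : ℝ, ∃ x ∈ X, T < x ∧ X ∩ Set.Ioc x (2 * x + R) = ∅)
    (hneg : ∀ T : ℝ, ∃ x ∈ -X, T < x) {N : ℕ} (hN : ∀ n, N ≤ n → 0 < S n) : False := by
  obtain ⟨B, hB⟩ : ∃ B, ∀ i ≤ N, |S i| ≤ B := by
    obtain ⟨B, hB⟩ := ((Set.finite_le_nat N).image (fun i => |S i|)).bddAbove
    exact ⟨B, fun i hi => hB ⟨i, hi, rfl⟩⟩
  have hB0 : 0 ≤ B := (abs_nonneg _).trans (hB 0 (Nat.zero_le _))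
  obtain ⟨y, hyX, hy⟩ := hneg B
  have hyu : ∀ n, -y ∈ unvisited X S n := by
    intro n
    refine mem_unvisited.2 ⟨hyX, fun i _ _ hi => ?_⟩
    rcases le_total i N with h' | h'
    · have := (abs_le.1 (hB i h')).1
      linarith
    · have := hN i h'
      linarith
  -- The gap length is chosen after `y`: the slack `R` has to cover the distance from 0 to the
  -- abandoned point `-y`.
  obtain ⟨R, hR⟩ := exists_nat_ge y
  obtain ⟨x, hxX, hx, hgap⟩ := hpos R B
  have hvis : ∃ m, x ≤ S (N + m) := by
    obtain ⟨m, hm1, hm2⟩ := ((h.eventually_abs_gt hX x).and (eventually_ge_atTop N)).exists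
    refine ⟨m - N, ?_⟩
    rw [Nat.add_sub_cancel' hm2]
    rw [abs_of_pos (hN m hm2)] at hm1
    exact hm1.le
  classical
  have hm := Nat.find_spec hvis
  have hmin := fun j => Nat.find_min (m := j) hvis
  set m := Nat.find hvis
  have hSN : S N < x := lt_of_le_of_lt ((le_abs_self _).trans (hB N le_rfl)) hx
  obtain ⟨k, hk⟩ : ∃ k, m = k + 1 := by
    refine ⟨m - 1, ?_⟩
    rcases Nat.eq_zero_or_pos m with h' | h'
    · rw [h', Nat.add_zero] at hm; linarith
    · omega
  have hlt : ∀ i, N ≤ i → i ≤ N + k → S i < x := by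
    intro i hi hik
    have := hmin (i - N) (by omega)
    rw [Nat.add_sub_cancel' hi] at this
    exact not_le.1 this
  have hxu : x ∈ unvisited X S (N + k) := by
    refine mem_unvisited.2 ⟨hxX, fun i _ hi hxi => ?_⟩
    rcases le_total i N with h' | h'
    · have := (abs_le.1 (hB i h')).2
      linarith
    · have := hlt i h' hi
      linarith
  rw [hk, ← Nat.add_assoc] at hm
  -- The first step reaching `x` or beyond cannot overshoot, since `x` is itself unvisited and
  -- nearer.
  have hxS : S (N + k + 1) = x := by
    have hd := (h.2 (N + k)).2 x hxu
    have h1 := hlt (N + k) (by omega) le_rfl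
    rw [Real.dist_eq, Real.dist_eq, abs_of_neg (by linarith), abs_of_neg (by linarith)] at hd
    linarith
  have hnext := (h.2 (N + k + 1))
  have hgt := h.gt_of_pos h0 hnext.1 (hN _ (by omega)) (N + k + 1) le_rfl
  have hd := hnext.2 _ (hyu _)
  rw [hxS] at hd hgt
  rw [Real.dist_eq, Real.dist_eq, abs_of_neg (by linarith), abs_of_pos (by linarith)] at hd
  have : S (N + k + 1 + 1) ∈ X ∩ Set.Ioc x (2 * x + R) :=
    ⟨h.mem (by omega), hgt, by linarith⟩
  rw [hgap] at this
  exact this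

lemma recurrent_of_gaps (hX : LocFinite X) (h0 : (0 : ℝ) ∉ X)
    (hpos : ∀ R : ℕ, ∀ T : ℝ, ∃ x ∈ X, T < x ∧ X ∩ Set.Ioc x (2 * x + R) = ∅)
    (hneg : ∀ R : ℕ, ∀ T : ℝ, ∃ x ∈ -X, T < x ∧ -X ∩ Set.Ioc x (2 * x + R) = ∅) :
    Recurrent X := by
  have hinf : X.Infinite := by
    intro hfin
    obtain ⟨B, hB⟩ := hfin.bddAbove
    obtain ⟨x, hx, hBx, -⟩ := hpos 0 B
    exact absurd (hB hx) (not_le.2 hBx)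
  refine ⟨exists_greedyWalk hX hinf, fun S hS => ?_⟩
  by_contra hJ
  rw [JumpsInfinitelyOften, not_frequently, eventually_atTop] at hJ
  obtain ⟨N, hN⟩ := hJ
  -- Time 0 is excluded because `S 0 = 0` has no side.
  set M := max N 1
  have hsign : ∀ n, M ≤ n → SignType.sign (S n) = SignType.sign (S M) := by
    intro n hn
    induction n, hn using Nat.le_induction with
    | base => rfl
    | succ n hn ih => rw [← ih]; exact not_not.1 (hN n ((le_max_left _ _).trans hn))
  have hM0 : S M ≠ 0 := fun h' => h0 (h' ▸ hS.mem (le_max_right _ _))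
  rcases lt_or_gt_of_ne hM0 with hs | hs
  · refine hS.neg.false_of_eventually_pos hX.neg (by simpa using h0) hneg (fun T => ?_)
      (N := M) fun n hn => ?_
    · obtain ⟨x, hx, hT, -⟩ := hpos 0 T
      exact ⟨x, by simpa using hx, hT⟩
    · have := hsign n hn
      rw [sign_neg hs, sign_eq_neg_one_iff] at this
      simpa using this
  · refine hS.false_of_eventually_pos hX h0 hpos (fun T => ?_) (N := M) fun n hn => ?_
    · obtain ⟨x, hx, hT, -⟩ := hneg 0 T
      exact ⟨x, hx, hT⟩
    · have := hsign n hn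
      rwa [sign_pos hs, sign_eq_one_iff] at this

end Deterministic

/-! ### Second moment method and Poisson hit-and-miss events -/

section Probability

variable {Ω : Type*} [MeasurableSpace Ω] {P : Measure Ω}

/-- This is Chebyshev's inequality for the number W of events that occur. Negative correlation gives
E[W²] ≤ s² + s, so the variance is at most the mean s, while (W - s)² = s² when no event occurs. -/
lemma sq_mul_measureReal_le_of_negCorr [IsProbabilityMeasure P] {A : ℕ → Set Ω} (hA : ∀ k, MeasurableSet (A k))
    (hc : ∀ i j, i < j → P.real (A i ∩ A j) ≤ P.real (A i) * P.real (A j)) (F : Finset ℕ) :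
    P.real (⋂ k ∈ F, (A k)ᶜ) * (∑ k ∈ F, P.real (A k)) ^ 2 ≤ ∑ k ∈ F, P.real (A k) := by
  set s := ∑ k ∈ F, P.real (A k) with hs
  let W : Ω → ℝ := fun ω => ∑ k ∈ F, (A k).indicator 1 ω
  have hint : ∀ B : Set Ω, MeasurableSet B → Integrable (B.indicator (1 : Ω → ℝ)) P := fun B hB =>
    (integrable_const (1 : ℝ)).indicator hB
  have hW : Integrable W P := integrable_finsetSum _ fun k _ => hint _ (hA k)
  have hWint : ∫ ω, W ω ∂P = s := by
    rw [integral_finsetSum _ fun k _ => hint _ (hA k)]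
    exact Finset.sum_congr rfl fun k _ => integral_indicator_one (hA k)
  have hW2eq : ∀ ω, W ω ^ 2 = ∑ i ∈ F, ∑ j ∈ F, (A i ∩ A j).indicator 1 ω := by
    intro ω
    rw [sq, Finset.sum_mul_sum]
    simp only [Set.inter_indicator_one, Pi.mul_apply]
  have hW2 : Integrable (fun ω => W ω ^ 2) P := by
    simp only [hW2eq]
    exact integrable_finsetSum _ fun i _ => integrable_finsetSum _ fun j _ =>
      hint _ ((hA i).inter (hA j))
  have hW2int : ∫ ω, W ω ^ 2 ∂P ≤ s ^ 2 + s := by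
    simp only [hW2eq]
    rw [integral_finsetSum _ fun i _ => integrable_finsetSum _ fun j _ =>
      hint _ ((hA i).inter (hA j))]
    have : ∀ i ∈ F, ∫ ω, ∑ j ∈ F, (A i ∩ A j).indicator (1 : Ω → ℝ) ω ∂P
        ≤ P.real (A i) * s + P.real (A i) := by
      intro i hi
      rw [integral_finsetSum _ fun j _ => hint _ ((hA i).inter (hA j))]
      calc ∑ j ∈ F, ∫ ω, (A i ∩ A j).indicator (1 : Ω → ℝ) ω ∂P
          = ∑ j ∈ F, P.real (A i ∩ A j) :=
            Finset.sum_congr rfl fun j _ => integral_indicator_one ((hA i).inter (hA j))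
        _ ≤ ∑ j ∈ F, (P.real (A i) * P.real (A j) + if i = j then P.real (A i) else 0) := by
            refine Finset.sum_le_sum fun j _ => ?_
            rcases lt_trichotomy i j with h | h | h
            · rw [if_neg h.ne, add_zero]; exact hc i j h
            · subst h
              rw [if_pos rfl, Set.inter_self]
              nlinarith [measureReal_nonneg (μ := P) (s := A i)]
            · rw [if_neg h.ne', add_zero, Set.inter_comm, mul_comm]; exact hc j i h
        _ = P.real (A i) * s + P.real (A i) := by
            rw [Finset.sum_add_distrib, ← Finset.mul_sum, Finset.sum_ite_eq, if_pos hi]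
    refine (Finset.sum_le_sum this).trans_eq ?_
    rw [Finset.sum_add_distrib, ← Finset.sum_mul, ← hs, sq]
  have hZ : Integrable (fun ω => (W ω - s) ^ 2) P := by
    have : (fun ω => (W ω - s) ^ 2) = fun ω => W ω ^ 2 - 2 * s * W ω + s ^ 2 := by
      funext ω; ring
    rw [this]
    exact (hW2.sub (hW.const_mul _)).add (integrable_const _)
  have hZint : ∫ ω, (W ω - s) ^ 2 ∂P ≤ s := by
    have : ∫ ω, (W ω - s) ^ 2 ∂P = ∫ ω, W ω ^ 2 ∂P - 2 * s * s + s ^ 2 := by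
      have h1 : (fun ω => (W ω - s) ^ 2) = fun ω => W ω ^ 2 - 2 * s * W ω + s ^ 2 := by
        funext ω; ring
      have h2 := hW.const_mul (2 * s)
      rw [h1, integral_add (f := fun ω => W ω ^ 2 - 2 * s * W ω) (hW2.sub h2)
        (integrable_const _), integral_sub hW2 h2, integral_const_mul, hWint, integral_const]
      simp
    rw [this]; nlinarith
  set B := ⋂ k ∈ F, (A k)ᶜ with hB
  have hBm : MeasurableSet B := Finset.measurableSet_biInter _ fun k _ => (hA k).compl
  calc P.real B * s ^ 2 = ∫ ω in B, (W ω - s) ^ 2 ∂P := by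
        rw [← smul_eq_mul, ← setIntegral_const]
        refine setIntegral_congr_fun hBm fun ω hω => ?_
        have : W ω = 0 := Finset.sum_eq_zero fun k hk =>
          Set.indicator_of_notMem (Set.mem_iInter₂.1 hω k hk) _
        simp only [this]; ring
    _ ≤ ∫ ω, (W ω - s) ^ 2 ∂P :=
        setIntegral_le_integral hZ (ae_of_all _ fun ω => sq_nonneg _)
    _ ≤ s := hZint

/-- The second Borel-Cantelli lemma for pairwise negatively correlated events. -/
lemma ae_frequently_of_negCorr [IsProbabilityMeasure P] {A : ℕ → Set Ω} (hA : ∀ k, MeasurableSet (A k))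
    (hc : ∀ i j, i < j → P.real (A i ∩ A j) ≤ P.real (A i) * P.real (A j))
    (hs : ¬ Summable fun k => P.real (A k)) : ∀ᵐ ω ∂P, ∃ᶠ k in atTop, ω ∈ A k := by
  simp only [frequently_atTop, ae_all_iff]
  intro N
  have htend : Tendsto (fun n => ∑ k ∈ Finset.range n, P.real (A (k + N))) atTop atTop := by
    refine (not_summable_iff_tendsto_nat_atTop_of_nonneg fun _ => measureReal_nonneg).1 ?_
    rwa [summable_nat_add_iff (f := fun k => P.real (A k)) N]
  have hzero : P.real (⋂ k : ℕ, (A (k + N))ᶜ) = 0 := by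
    refine le_antisymm ?_ measureReal_nonneg
    refine ge_of_tendsto htend.inv_tendsto_atTop ?_
    filter_upwards [htend.eventually_gt_atTop 0] with n hn
    -- Dividing by the square of the partial sum bounds the probability of no occurrence by its
    -- inverse, which tends to 0.
    have h1 := sq_mul_measureReal_le_of_negCorr (P := P) (A := fun k => A (k + N))
      (fun k => hA _) (fun i j hij => hc _ _ (by omega)) (Finset.range n)
    have h2 : P.real (⋂ k : ℕ, (A (k + N))ᶜ) ≤ P.real (⋂ k ∈ Finset.range n, (A (k + N))ᶜ) :=
      measureReal_mono (Set.iInter_mono fun k => Set.subset_iInter fun _ => le_rfl)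
    simp only [Pi.inv_apply]
    set s := ∑ k ∈ Finset.range n, P.real (A (k + N))
    rw [← one_div, le_div_iff₀ hn]
    nlinarith [mul_le_mul_of_nonneg_right h2 (sq_nonneg s)]
  rw [measureReal_eq_zero_iff] at hzero
  rw [ae_iff]
  refine measure_mono_null (fun ω hω => ?_) hzero
  simp only [Set.mem_ofPred_eq, not_exists, not_and] at hω
  exact Set.mem_iInter.2 fun k => hω _ (Nat.le_add_left N k)

variable {X : Ω → Set ℝ} {μ : Measure ℝ}

lemma measurableSet_count_eq (hX : IsPoissonProcess P X μ) {A : Set ℝ} (hA : MeasurableSet A)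
    (k : ℕ∞) : MeasurableSet {ω | count X A ω = k} :=
  hX.measurable_count A hA (MeasurableSet.of_discrete (s := {k}))

lemma measureReal_count_eq_zero (hX : IsPoissonProcess P X μ) {A : Set ℝ}
    (hA : MeasurableSet A) (hfin : μ A ≠ ∞) :
    P.real {ω | count X A ω = 0} = Real.exp (-μ.real A) := by
  have := hX.law A hA hfin 0
  rw [Nat.cast_zero] at this
  rw [measureReal_def, this, ← measureReal_def, poissonMeasure_real_singleton]
  simp [measureReal_def, ENNReal.coe_toNNReal_eq_toReal]

/-- The Poisson weights on the finite values already sum to 1. -/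
lemma ae_count_ne_top [IsProbabilityMeasure P] (hX : IsPoissonProcess P X μ) {A : Set ℝ}
    (hA : MeasurableSet A) (hfin : μ A ≠ ∞) : ∀ᵐ ω ∂P, count X A ω ≠ ⊤ := by
  have h1 : P (⋃ k : ℕ, {ω | count X A ω = (k : ℕ∞)}) = 1 := by
    rw [measure_iUnion (f := fun k : ℕ => {ω | count X A ω = (k : ℕ∞)}) ?_
      fun k => measurableSet_count_eq hX hA k]
    · simp only [hX.law A hA hfin]
      rw [← measure_iUnion (fun i j hij => Set.disjoint_singleton.2 hij) fun k => MeasurableSet.singleton k,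
        Set.iUnion_of_singleton, measure_univ]
    · intro i j hij
      refine Set.disjoint_left.2 fun ω h1 h2 => hij ?_
      simp only [Set.mem_ofPred_eq] at h1 h2
      exact_mod_cast h1.symm.trans h2
  have h2 := (prob_compl_eq_zero_iff
    (MeasurableSet.iUnion fun k : ℕ => measurableSet_count_eq hX hA k)).2 h1
  rw [ae_iff]
  refine measure_mono_null (fun ω hω => ?_) h2
  simp only [Set.mem_ofPred_eq, not_not] at hω
  simp [hω]

lemma ae_inter_eq_empty [IsProbabilityMeasure P] (hX : IsPoissonProcess P X μ) {A : Set ℝ}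
    (hA : MeasurableSet A) (h0 : μ A = 0) : ∀ᵐ ω ∂P, X ω ∩ A = ∅ := by
  have h1 := measureReal_count_eq_zero hX hA (by simp [h0])
  rw [measureReal_def μ, h0, ENNReal.toReal_zero, neg_zero, Real.exp_zero, measureReal_def,
    ENNReal.toReal_eq_one_iff] at h1
  have h2 := (prob_compl_eq_zero_iff (measurableSet_count_eq hX hA 0)).2 h1
  rw [ae_iff]
  refine measure_mono_null (fun ω hω => ?_) h2
  simpa [count] using hω

/-- The event that `X` has a point in `I` and no point in `J`. -/
def hitMiss (X : Ω → Set ℝ) (I J : Set ℝ) : Set Ω := {ω | count X I ω ≠ 0 ∧ count X J ω = 0}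

lemma mem_hitMiss {Ω : Type*} {X : Ω → Set ℝ} {I J : Set ℝ} {ω : Ω} :
    ω ∈ hitMiss X I J ↔ (X ω ∩ I).Nonempty ∧ X ω ∩ J = ∅ := by
  simp [hitMiss, count, Set.nonempty_iff_ne_empty]

lemma measurableSet_hitMiss (hX : IsPoissonProcess P X μ) {I J : Set ℝ} (hI : MeasurableSet I)
    (hJ : MeasurableSet J) : MeasurableSet (hitMiss X I J) :=
  (measurableSet_count_eq hX hI 0).compl.inter (measurableSet_count_eq hX hJ 0)

lemma measure_hitMiss (hX : IsPoissonProcess P X μ) {I J : Set ℝ} (hI : MeasurableSet I)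
    (hJ : MeasurableSet J) (hd : Disjoint I J) :
    P (hitMiss X I J) = P {ω | count X I ω ≠ 0} * P {ω | count X J ω = 0} := by
  have h := (hX.indep 2 ![I, J] (by simp [Fin.forall_fin_two, hI, hJ])
    (by simp [Fin.forall_fin_two, hd, hd.symm])).measure_inter_preimage_eq_mul
      Finset.univ (sets := ![{0}ᶜ, {0}]) (fun i _ => MeasurableSet.of_discrete)
  simpa [Fin.prod_univ_two, hitMiss, Set.ofPred_and, Set.preimage, Fin.forall_fin_two,
    ← Set.iInter_inter_distrib, Set.iInter_ofPred] using h

lemma measure_hitMiss_inter (hX : IsPoissonProcess P X μ) {I J I' J' : Set ℝ}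
    (hI : MeasurableSet I) (hJ : MeasurableSet J) (hI' : MeasurableSet I')
    (hJ' : MeasurableSet J') (h1 : Disjoint I J) (h2 : Disjoint I I') (h3 : Disjoint I J')
    (h4 : Disjoint J I') (h5 : Disjoint J J') (h6 : Disjoint I' J') :
    P (hitMiss X I J ∩ hitMiss X I' J') = P (hitMiss X I J) * P (hitMiss X I' J') := by
  have h := (hX.indep 4 ![I, J, I', J'] (by simp [Fin.forall_fin_succ, hI, hJ, hI', hJ'])
    (by simp [Fin.forall_fin_succ, h1, h2, h3, h4, h5, h6, h1.symm, h2.symm, h3.symm, h4.symm,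
      h5.symm, h6.symm])).measure_inter_preimage_eq_mul
      Finset.univ (sets := ![{0}ᶜ, {0}, {0}ᶜ, {0}]) (fun i _ => MeasurableSet.of_discrete)
  rw [measure_hitMiss hX hI hJ h1, measure_hitMiss hX hI' hJ' h6]
  have e : hitMiss X I J ∩ hitMiss X I' J' = {ω | count X I ω ≠ 0 ∧ count X J ω = 0 ∧
      count X I' ω ≠ 0 ∧ count X J' ω = 0} := by
    ext ω; simp [hitMiss, and_assoc]
  rw [e]
  simpa [Fin.prod_univ_succ, Set.preimage, Fin.forall_fin_succ, Set.iInter_ofPred, mul_assoc]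
    using h

lemma measureReal_hitMiss [IsProbabilityMeasure P] (hX : IsPoissonProcess P X μ) {I J : Set ℝ} (hI : MeasurableSet I)
    (hJ : MeasurableSet J) (hd : Disjoint I J) (hIf : μ I ≠ ∞) (hJf : μ J ≠ ∞) :
    P.real (hitMiss X I J) = (1 - Real.exp (-μ.real I)) * Real.exp (-μ.real J) := by
  rw [measureReal_def, measure_hitMiss hX hI hJ hd, ENNReal.toReal_mul, ← measureReal_def,
    ← measureReal_def, measureReal_count_eq_zero hX hJ hJf, ← measureReal_count_eq_zero hX hI hIf,
    ← probReal_compl_eq_one_sub (measurableSet_count_eq hX hI 0)]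
  rfl

lemma ae_locFinite [IsProbabilityMeasure P] (hX : IsPoissonProcess P X μ) (hfin : ∀ a b : ℝ, μ (Set.Icc a b) ≠ ∞) :
    ∀ᵐ ω ∂P, LocFinite (X ω) := by
  have h : ∀ᵐ ω ∂P, ∀ M : ℕ, count X (Set.Icc (-M : ℝ) M) ω ≠ ⊤ :=
    ae_all_iff.2 fun M => ae_count_ne_top hX measurableSet_Icc (hfin _ _)
  filter_upwards [h] with ω hω M
  obtain ⟨m, hm⟩ := exists_nat_ge M
  refine (Set.encard_ne_top_iff.1 (hω m)).subset
    (Set.inter_subset_inter_right _ (Set.Icc_subset_Icc (by linarith) hm))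

lemma count_neg {Ω : Type*} {X : Ω → Set ℝ} (A : Set ℝ) : count (fun ω => -X ω) A = count X (-A) := by
  funext ω
  have : -X ω ∩ A = -(X ω ∩ -A) := by ext x; simp
  rw [count, count, this, ← Set.image_neg_eq_neg, neg_injective.encard_image]

/-- Transfers results about the right half-line to the left one. -/
lemma IsPoissonProcess.neg (hX : IsPoissonProcess P X μ)
    (hμ : ∀ A, MeasurableSet A → μ (-A) = μ A) : IsPoissonProcess P (fun ω => -X ω) μ where
  measurable_count A hA := by rw [count_neg]; exact hX.measurable_count _ hA.neg
  indep k A hA hd := by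
    simp only [count_neg]
    refine hX.indep k (fun i => -A i) (fun i => (hA i).neg) fun i j hij => ?_
    refine Set.disjoint_left.2 fun x h1 h2 => Set.disjoint_left.1 (hd i j hij) h1 h2
  law A hA hfin k := by
    rw [← hμ A hA] at hfin ⊢
    rw [count_neg]; exact hX.law _ hA.neg hfin k
  law_top A hA htop := by
    rw [← hμ A hA] at htop
    rw [count_neg]; exact hX.law_top _ hA.neg htop

end Probability

/-! ### Iterated logarithms and Bertrand series -/

section IteratedLog

lemma truncLog_eq_log_max (t : ℝ) : truncLog t = Real.log (max 1 t) := by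
  unfold truncLog
  split_ifs with h
  · rw [max_eq_right h.le]
  · rw [max_eq_left (not_lt.1 h), Real.log_one]

lemma truncLog_nonneg (t : ℝ) : 0 ≤ truncLog t := by
  rw [truncLog_eq_log_max]; exact Real.log_nonneg (le_max_left _ _)

lemma exp_truncLog (t : ℝ) : Real.exp (truncLog t) = max 1 t := by
  rw [truncLog_eq_log_max, Real.exp_log (lt_of_lt_of_le one_pos (le_max_left _ _))]

lemma monotone_truncLog : Monotone truncLog := fun x y h => by
  rw [truncLog_eq_log_max, truncLog_eq_log_max]
  exact Real.log_le_log (lt_of_lt_of_le one_pos (le_max_left _ _)) (max_le_max le_rfl h)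

/-- A mean value bound: the exponential factor equals 1 / max(1, x), the slope of the logarithm at
the left end. -/
lemma truncLog_sub_le {x y : ℝ} (h : x ≤ y) :
    truncLog y - truncLog x ≤ (y - x) * Real.exp (-truncLog x) := by
  rw [Real.exp_neg, exp_truncLog, truncLog_eq_log_max, truncLog_eq_log_max]
  have hx : 0 < max 1 x := lt_of_lt_of_le one_pos (le_max_left _ _)
  have hy : 0 < max 1 y := lt_of_lt_of_le one_pos (le_max_left _ _)
  rw [← Real.log_div hy.ne' hx.ne']
  have h1 : max 1 y - max 1 x ≤ y - x := by
    rcases le_total 1 x with h1 | h1 <;> rcases le_total 1 y with h2 | h2 <;>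
      simp [h1, h2] <;> linarith
  calc Real.log (max 1 y / max 1 x) ≤ max 1 y / max 1 x - 1 :=
        Real.log_le_sub_one_of_pos (by positivity)
    _ = (max 1 y - max 1 x) * (max 1 x)⁻¹ := by field_simp
    _ ≤ (y - x) * (max 1 x)⁻¹ := by gcongr

lemma truncLog_sub_le_sub {x y : ℝ} (h : x ≤ y) : truncLog y - truncLog x ≤ y - x := by
  refine (truncLog_sub_le h).trans ?_
  have := Real.exp_le_one_iff.2 (neg_nonpos.2 (truncLog_nonneg x))
  nlinarith

/-- The matching bound uses the slope at the right end; below 1 it would fail, as `truncLog` is flat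
there. -/
lemma le_truncLog_sub {x y : ℝ} (hx : 1 ≤ x) (h : x ≤ y) :
    (y - x) * Real.exp (-truncLog y) ≤ truncLog y - truncLog x := by
  rw [Real.exp_neg, exp_truncLog, truncLog_eq_log_max, truncLog_eq_log_max,
    max_eq_right hx, max_eq_right (hx.trans h)]
  have hx0 : 0 < x := by linarith
  have hy0 : 0 < y := by linarith
  have := Real.log_le_sub_one_of_pos (div_pos hx0 hy0)
  rw [Real.log_div hx0.ne' hy0.ne'] at this
  have e : (y - x) * y⁻¹ = 1 - x / y := by field_simp
  rw [e]; linarith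

lemma truncLog_le {t : ℝ} (ht : 0 ≤ t) : truncLog t ≤ t := by
  have := truncLog_sub_le_sub ht
  simpa [truncLog] using this

lemma tendsto_truncLog : Tendsto truncLog atTop atTop := by
  refine Real.tendsto_log_atTop.congr' ?_
  filter_upwards [eventually_gt_atTop 1] with t ht
  rw [truncLog, if_pos ht]

lemma eventually_truncLog_le_mul {δ : ℝ} (hδ : 0 < δ) : ∀ᶠ t in atTop, truncLog t ≤ δ * t := by
  filter_upwards [eventually_gt_atTop 1, Real.isLittleO_log_id_atTop.bound hδ] with t ht h
  rw [truncLog, if_pos ht]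
  simp only [id, Real.norm_eq_abs] at h
  rw [abs_of_pos (by linarith : (0 : ℝ) < t)] at h
  exact (le_abs_self _).trans h

lemma monotone_iterLog (i : ℕ) : Monotone (iterLog i) := by
  induction i with
  | zero => exact fun x y h => h
  | succ i ih => exact fun x y h => monotone_truncLog (ih h)

lemma iterLog_succ_nonneg (i : ℕ) (t : ℝ) : 0 ≤ iterLog (i + 1) t := truncLog_nonneg _

lemma iterLog_nonneg (i : ℕ) {t : ℝ} (ht : 0 ≤ t) : 0 ≤ iterLog i t := by
  cases i with
  | zero => exact ht
  | succ i => exact iterLog_succ_nonneg i t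

lemma tendsto_iterLog (i : ℕ) : Tendsto (iterLog i) atTop atTop := by
  induction i with
  | zero => exact tendsto_id
  | succ i ih => exact tendsto_truncLog.comp ih

lemma iterLog_sub_le_sub (i : ℕ) {x y : ℝ} (h : x ≤ y) :
    iterLog i y - iterLog i x ≤ y - x := by
  induction i with
  | zero => exact le_rfl
  | succ i ih => exact (truncLog_sub_le_sub (monotone_iterLog i h)).trans ih

lemma iterLog_succ' (i : ℕ) (t : ℝ) : iterLog (i + 1) t = iterLog i (truncLog t) := by
  induction i with
  | zero => rfl
  | succ i ih => rw [iterLog, ih]; rfl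

lemma iterLog_antitone {t : ℝ} (ht : 0 ≤ t) : Antitone fun i => iterLog i t :=
  antitone_nat_of_succ_le fun i => truncLog_le (iterLog_nonneg i ht)

lemma eventually_iterLog_succ_le_mul (i : ℕ) {δ : ℝ} (hδ : 0 < δ) :
    ∀ᶠ t in atTop, iterLog (i + 1) t ≤ δ * iterLog i t :=
  (tendsto_iterLog i).eventually (eventually_truncLog_le_mul hδ)

/-- The sum `log^{(1)} t + ⋯ + log^{(m)} t`. -/
noncomputable def sumLog (m : ℕ) (t : ℝ) : ℝ := ∑ j ∈ Finset.range m, iterLog (j + 1) t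

/-- A discrete chain rule: exp(-`sumLog m t`) is the product of the reciprocals of t, log t, …,
log^{(m-1)} t (each truncated below at 1), that is, the derivative of log^{(m)}. The Bertrand terms
are thus compared with increments that telescope. -/
lemma iterLog_add_one_sub_le (m : ℕ) (t : ℝ) :
    iterLog m (t + 1) - iterLog m t ≤ Real.exp (-sumLog m t) := by
  induction m with
  | zero => simp [iterLog, sumLog]
  | succ m ih =>
    rw [sumLog, Finset.sum_range_succ, neg_add, Real.exp_add]
    refine (truncLog_sub_le (monotone_iterLog m (by linarith))).trans ?_
    exact mul_le_mul_of_nonneg_right ih (Real.exp_pos _).le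

lemma eventually_le_iterLog_add_one_sub (m : ℕ) :
    ∀ᶠ t in atTop, Real.exp (-sumLog m (t + 1)) ≤ iterLog m (t + 1) - iterLog m t := by
  induction m with
  | zero => simp [iterLog, sumLog]
  | succ m ih =>
    filter_upwards [ih, (tendsto_iterLog m).eventually_ge_atTop 1] with t ht h1
    rw [sumLog, Finset.sum_range_succ, neg_add, Real.exp_add]
    refine le_trans ?_ (le_truncLog_sub h1 (monotone_iterLog m (by linarith)))
    exact mul_le_mul_of_nonneg_right ht (Real.exp_pos _).le

/-- Divergence of the Bertrand series `∑ 1 / (b log b ⋯ log^{(m-1)} b)`. -/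
lemma not_summable_exp_neg_sumLog (m : ℕ) :
    ¬ Summable fun b : ℕ => Real.exp (-sumLog m b) := by
  intro hs
  have hle : ∀ N : ℕ, iterLog m N ≤ iterLog m 0 + ∑' b : ℕ, Real.exp (-sumLog m b) := by
    intro N
    have h1 : iterLog m N - iterLog m 0 ≤ ∑ b ∈ Finset.range N, Real.exp (-sumLog m b) := by
      induction N with
      | zero => simp
      | succ N ih =>
        rw [Finset.sum_range_succ]
        have := iterLog_add_one_sub_le m N
        push_cast
        linarith
    have h2 := hs.sum_le_tsum (Finset.range N) fun _ _ => (Real.exp_pos _).le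
    linarith
  obtain ⟨N, hN⟩ := (((tendsto_iterLog m).comp tendsto_natCast_atTop_atTop).eventually_gt_atTop
    (iterLog m 0 + ∑' b : ℕ, Real.exp (-sumLog m b))).exists
  exact absurd (hle N) (not_le.2 hN)

/-- Convergence of the Bertrand series
`∑ 1 / (b log b ⋯ log^{(m-2)} b (log^{(m-1)} b)^{1 + ε})`. -/
lemma summable_exp_neg_sumLog (m : ℕ) {ε : ℝ} (hε : 0 < ε) :
    Summable fun b : ℕ => Real.exp (-(sumLog m b + ε * iterLog m b)) := by
  obtain ⟨N, hN⟩ := eventually_atTop.1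
    (tendsto_natCast_atTop_atTop.eventually (eventually_le_iterLog_add_one_sub m))
  rw [← summable_nat_add_iff (N + 1)]
  -- `φ` is a discrete primitive: the term at b + 1 is at most (φ b - φ (b + 1)) / ε. The lower
  -- increment bound is evaluated at t + 1, whence the shift by `N + 1`.
  set φ : ℕ → ℝ := fun b => Real.exp (-(ε * iterLog m b)) with hφ
  refine summable_of_sum_range_le (c := φ N / ε) (fun _ => (Real.exp_pos _).le) fun n => ?_
  have key : ∀ n : ℕ, ∑ k ∈ Finset.range n,
      Real.exp (-(sumLog m ↑(k + (N + 1)) + ε * iterLog m ↑(k + (N + 1))))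
      ≤ (φ N - φ (N + n)) / ε := by
    intro n
    induction n with
    | zero => simp
    | succ n ih =>
      rw [Finset.sum_range_succ]
      have h1 := hN (N + n) (by omega)
      have e1 : ((n + (N + 1) : ℕ) : ℝ) = ((N + n : ℕ) : ℝ) + 1 := by push_cast; ring
      have e2 : ((N + (n + 1) : ℕ) : ℝ) = ((N + n : ℕ) : ℝ) + 1 := by push_cast; ring
      simp only [hφ, e1, e2] at ih ⊢
      set t : ℝ := ((N + n : ℕ) : ℝ)
      have h2 : Real.exp (-(ε * iterLog m t)) =
          Real.exp (-(ε * iterLog m (t + 1))) *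
            Real.exp (ε * (iterLog m (t + 1) - iterLog m t)) := by
        rw [← Real.exp_add]; congr 1; ring
      have h3 := Real.add_one_le_exp (ε * (iterLog m (t + 1) - iterLog m t))
      have h4 : Real.exp (-(ε * iterLog m (t + 1))) * (ε * Real.exp (-sumLog m (t + 1)))
          ≤ Real.exp (-(ε * iterLog m t)) - Real.exp (-(ε * iterLog m (t + 1))) := by
        rw [h2]
        have h5 : ε * Real.exp (-sumLog m (t + 1)) ≤ ε * (iterLog m (t + 1) - iterLog m t) := by
          gcongr
        nlinarith [Real.exp_pos (-(ε * iterLog m (t + 1)))]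
      rw [neg_add, Real.exp_add]
      rw [le_div_iff₀ hε] at ih ⊢
      linarith
  refine (key n).trans ?_
  gcongr
  linarith [Real.exp_pos (-(ε * iterLog m ↑(N + n)))]

lemma sum_range_split (f : ℕ → ℝ) {J N : ℕ} (h : J < N) :
    ∑ j ∈ Finset.range N, f j =
      ∑ j ∈ Finset.range J, f j + f J + ∑ j ∈ Finset.range (N - (J + 1)), f (J + 1 + j) := by
  obtain ⟨r, rfl⟩ : ∃ r, N = J + 1 + r := ⟨N - (J + 1), by omega⟩
  rw [Finset.sum_range_add, Finset.sum_range_succ, Nat.add_sub_cancel_left]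

lemma sumLog_add_le {β : ℕ → ℝ} {J N : ℕ} (hJN : J < N) (h1 : ∀ j < J, β j = 1)
    (hge : ∀ j, J < j → 0 ≤ β j) (t : ℝ) :
    sumLog (J + 1) t + (β J - 1) * iterLog (J + 1) t
      ≤ ∑ j ∈ Finset.range N, β j * iterLog (j + 1) t := by
  rw [sum_range_split _ hJN, sumLog, Finset.sum_range_succ]
  have e : ∑ j ∈ Finset.range J, β j * iterLog (j + 1) t =
      ∑ j ∈ Finset.range J, iterLog (j + 1) t :=
    Finset.sum_congr rfl fun j hj => by rw [h1 j (Finset.mem_range.1 hj), one_mul]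
  have h3 : 0 ≤ ∑ j ∈ Finset.range (N - (J + 1)), β (J + 1 + j) * iterLog (J + 1 + j + 1) t :=
    Finset.sum_nonneg fun j _ => mul_nonneg (hge _ (by omega)) (iterLog_succ_nonneg _ _)
  rw [e]
  linarith

/-- The deficit (1 - β J) log^{(J+1)} t eventually outweighs all later terms together, since these
are at most a constant times log^{(J+2)} t, whatever their signs. -/
lemma eventually_le_sumLog {β : ℕ → ℝ} {J N : ℕ} (hJN : J < N) (h1 : ∀ j < J, β j = 1)
    (hlt : β J < 1) :
    ∀ᶠ t in atTop, ∑ j ∈ Finset.range N, β j * iterLog (j + 1) t ≤ sumLog (J + 1) t := by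
  set C := ∑ j ∈ Finset.range (N - (J + 1)), |β (J + 1 + j)| with hC
  have hC0 : 0 ≤ C := Finset.sum_nonneg fun _ _ => abs_nonneg _
  filter_upwards [eventually_ge_atTop 0, eventually_iterLog_succ_le_mul (J + 1)
    (div_pos (sub_pos.2 hlt) (by linarith : 0 < C + 1))] with t ht0 ht
  rw [sum_range_split _ hJN, sumLog, Finset.sum_range_succ]
  have e : ∑ j ∈ Finset.range J, β j * iterLog (j + 1) t =
      ∑ j ∈ Finset.range J, iterLog (j + 1) t :=
    Finset.sum_congr rfl fun j hj => by rw [h1 j (Finset.mem_range.1 hj), one_mul]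
  have h3 : ∑ j ∈ Finset.range (N - (J + 1)), β (J + 1 + j) * iterLog (J + 1 + j + 1) t
      ≤ C * iterLog (J + 1 + 1) t := by
    rw [hC, Finset.sum_mul]
    refine Finset.sum_le_sum fun j _ => ?_
    have := iterLog_antitone ht0 (show J + 1 + 1 ≤ J + 1 + j + 1 by omega)
    simp only at this
    have h0 := iterLog_succ_nonneg (J + 1 + j) t
    calc β (J + 1 + j) * iterLog (J + 1 + j + 1) t
        ≤ |β (J + 1 + j)| * iterLog (J + 1 + j + 1) t := by gcongr; exact le_abs_self _
      _ ≤ _ := by gcongr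
  have h4 : C * iterLog (J + 1 + 1) t ≤ (1 - β J) * iterLog (J + 1) t := by
    have h0 := iterLog_succ_nonneg (J + 1) t
    rw [div_mul_eq_mul_div, le_div_iff₀ (by linarith)] at ht
    linarith
  rw [e]
  linarith

end IteratedLog

/-! ### The convergence criterion for ∑ g exp(-g) -/

section Criterion

/-- The coefficients `a_2, …, a_n`, shifted to start at `0` and continued by `0`. -/
noncomputable def coeff (n : ℕ) (a : ℕ → ℝ) (j : ℕ) : ℝ := if j + 2 ≤ n then a (j + 2) else 0

/-- The function `∑ a_i log^{(i-1)}`. -/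
noncomputable def rate (n : ℕ) (a : ℕ → ℝ) (t : ℝ) : ℝ :=
  ∑ j ∈ Finset.range n, coeff n a j * iterLog (j + 1) t

variable {n : ℕ} {a : ℕ → ℝ}

lemma coeff_nonneg (ha : ∀ i, 2 ≤ i → i ≤ n → 0 ≤ a i) (j : ℕ) : 0 ≤ coeff n a j := by
  unfold coeff
  split_ifs with h
  · exact ha _ (by omega) h
  · exact le_rfl

lemma tendsto_rate (ha : ∀ i, 2 ≤ i → i ≤ n → 0 ≤ a i) (ha0 : ∃ i, 2 ≤ i ∧ i ≤ n ∧ a i ≠ 0) :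
    Tendsto (rate n a) atTop atTop := by
  obtain ⟨i, h2, hn, h0⟩ := ha0
  have hc : 0 < coeff n a (i - 2) := by
    rw [coeff, if_pos (by omega), Nat.sub_add_cancel h2]
    exact lt_of_le_of_ne (ha i h2 hn) h0.symm
  refine tendsto_atTop_mono (fun t => ?_) ((tendsto_iterLog (i - 2 + 1)).const_mul_atTop hc)
  exact Finset.single_le_sum (f := fun j => coeff n a j * iterLog (j + 1) t)
    (fun j _ => mul_nonneg (coeff_nonneg ha j) (iterLog_succ_nonneg _ _))
    (Finset.mem_range.2 (by omega))

lemma rate_le (ha : ∀ i, 2 ≤ i → i ≤ n → 0 ≤ a i) {t : ℝ} (ht : 0 ≤ t) :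
    rate n a t ≤ (∑ j ∈ Finset.range n, coeff n a j) * iterLog 1 t := by
  rw [Finset.sum_mul]
  exact Finset.sum_le_sum fun j _ =>
    mul_le_mul_of_nonneg_left (iterLog_antitone ht (by omega)) (coeff_nonneg ha j)

/-- `J` is the first index whose corrected coefficient differs from 1. The case `J = 1` is the
clause on a_3, and `J ≥ 2` is the last clause with m = J + 1. -/
lemma transienceCondition_iff {J : ℕ} (hn : 2 ≤ n) (h0 : coeff n a 0 = 1) (hJ : 1 ≤ J)
    (h1 : ∀ j < J, coeff n a j - (if j = 1 then 1 else 0) = 1)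
    (hne : coeff n a J - (if J = 1 then 1 else 0) ≠ 1) :
    TransienceCondition n a ↔ 1 < coeff n a J - (if J = 1 then 1 else 0) := by
  have ha2 : a 2 = 1 := by simpa [coeff, hn] using h0
  constructor
  · rintro (h | ⟨h3, -, h⟩ | ⟨h3, -, h, m, hm, hmn, hi, hgt⟩)
    · exact absurd h (by rw [ha2]; exact lt_irrefl _)
    · have hc : coeff n a 1 = a 3 := by rw [coeff, if_pos h3]
      have : J = 1 := by
        by_contra hJ1
        have := h1 1 (by omega)
        rw [hc, if_pos rfl] at this
        linarith
      subst this
      rw [hc, if_pos rfl]; linarith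
    · have hc : coeff n a (m - 1) = a (m + 1) := by
        rw [coeff, if_pos (by omega)]; congr 1; omega
      have hJm : J = m - 1 := by
        rcases lt_trichotomy J (m - 1) with hlt | he | hgt'
        · refine absurd ?_ hne
          rw [coeff, if_pos (by omega)]
          rcases Nat.lt_or_ge 1 J with h' | h'
          · rw [if_neg (by omega), hi _ (by omega) (by omega), sub_zero]
          · obtain rfl : J = 1 := by omega
            rw [if_pos rfl, h]; norm_num
        · exact he
        · have := h1 _ hgt'
          rw [hc, if_neg (by omega)] at this
          linarith
      rw [hJm, hc, if_neg (by omega), sub_zero]; exact hgt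
  · intro h
    have hJn : J + 2 ≤ n := by
      by_contra hlt
      rw [coeff, if_neg hlt] at h
      split_ifs at h <;> linarith
    right
    rcases Nat.lt_or_ge 1 J with h' | h'
    · right
      have h3 := h1 1 h'
      rw [coeff, if_pos (by omega), if_pos rfl] at h3
      refine ⟨by omega, ha2, by linarith, J + 1, by omega, by omega, fun i hi4 hiJ => ?_, ?_⟩
      · have := h1 (i - 2) (by omega)
        rw [coeff, if_pos (by omega), if_neg (by omega), Nat.sub_add_cancel (by omega)] at this
        linarith
      · rw [coeff, if_pos hJn, if_neg (by omega)] at h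
        simpa using h
    · left
      obtain rfl : J = 1 := by omega
      rw [coeff, if_pos hJn, if_pos rfl] at h
      exact ⟨by omega, ha2, by linarith⟩

lemma summable_of_eventually_le {f g : ℕ → ℝ} (hg : Summable g) {C : ℝ}
    (hf : ∀ᶠ b in atTop, 0 ≤ f b) (h : ∀ᶠ b in atTop, f b ≤ C * g b) : Summable f := by
  refine summable_of_isBigO_nat hg (Asymptotics.IsBigO.of_bound |C| ?_)
  filter_upwards [hf, h] with b h1 h2
  rw [Real.norm_of_nonneg h1, Real.norm_eq_abs, ← abs_mul]
  exact h2.trans (le_abs_self _)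

/-- The series deciding between transience and recurrence. -/
lemma summable_rate_iff (hn : 2 ≤ n) (ha : ∀ i, 2 ≤ i → i ≤ n → 0 ≤ a i)
    (ha0 : ∃ i, 2 ≤ i ∧ i ≤ n ∧ a i ≠ 0) :
    (Summable fun b : ℕ => rate n a b * Real.exp (-rate n a b)) ↔ TransienceCondition n a := by
  have hcast := tendsto_natCast_atTop_atTop (R := ℝ)
  have hrate := (tendsto_rate ha ha0).comp hcast
  have hrate1 : ∀ᶠ b : ℕ in atTop, 1 ≤ rate n a b := hrate.eventually_ge_atTop 1
  have hrate0 : ∀ᶠ b : ℕ in atTop, 0 ≤ rate n a b * Real.exp (-rate n a b) := by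
    filter_upwards [hrate1] with b hb
    exact mul_nonneg (by linarith) (Real.exp_pos _).le
  rcases lt_trichotomy (coeff n a 0) 1 with h0 | h0 | h0
  · have ha2 : a 2 < 1 := by simpa [coeff, hn] using h0
    refine iff_of_false (fun hs => ?_) ?_
    · refine not_summable_exp_neg_sumLog 1 (summable_of_eventually_le hs (C := 1)
        (.of_forall fun _ => (Real.exp_pos _).le) ?_)
      filter_upwards [hrate1, hcast.eventually (eventually_le_sumLog (β := coeff n a)
        (show 0 < n by omega) (by simp) h0)] with b h1 h2
      have : Real.exp (-sumLog 1 b) ≤ Real.exp (-rate n a b) :=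
        Real.exp_le_exp.2 (neg_le_neg h2)
      nlinarith [Real.exp_pos (-rate n a b)]
    · rintro (h | ⟨-, h, -⟩ | ⟨-, h, -⟩) <;> linarith
  -- The index `n - 1` always qualifies: it lies one past the last coefficient, so its corrected
  -- value is 0 or -1.
  · have hbad : ∃ j, 1 ≤ j ∧ j < n ∧ coeff n a j - (if j = 1 then 1 else 0) ≠ 1 := by
      refine ⟨n - 1, by omega, by omega, ?_⟩
      rw [coeff, if_neg (by omega)]
      split_ifs <;> norm_num
    classical
    obtain ⟨hJ, hJn, hne⟩ := Nat.find_spec hbad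
    have hmin := fun j => Nat.find_min (m := j) hbad
    set J := Nat.find hbad
    set β : ℕ → ℝ := fun j => coeff n a j - (if j = 1 then 1 else 0) with hβ
    have h1 : ∀ j < J, β j = 1 := by
      intro j hj
      rcases Nat.eq_zero_or_pos j with rfl | hj0
      · simp [hβ, h0]
      · have := hmin j hj
        simp only [not_and, not_not] at this
        exact this hj0 (by omega)
    rw [transienceCondition_iff hn h0 hJ h1 hne]
    have hsplit : ∀ t, rate n a t = ∑ j ∈ Finset.range n, β j * iterLog (j + 1) t
        + iterLog 2 t := by
      intro t
      simp only [hβ, sub_mul, Finset.sum_sub_distrib, ite_mul, one_mul, zero_mul]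
      rw [Finset.sum_ite_eq', if_pos (Finset.mem_range.2 (by omega)), rate]
      ring
    -- The factor log b = exp(log^{(2)} b) is absorbed into the exponent, lowering the coefficient
    -- at index 1.
    have hexp : ∀ᶠ b : ℕ in atTop, Real.exp (-rate n a b) * iterLog 1 b =
        Real.exp (-∑ j ∈ Finset.range n, β j * iterLog (j + 1) b) := by
      filter_upwards [((tendsto_iterLog 1).comp hcast).eventually_ge_atTop 1] with b hb
      have h2 : Real.exp (iterLog 2 b) = iterLog 1 b := by
        rw [show iterLog 2 b = truncLog (iterLog 1 b) from rfl, exp_truncLog,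
          max_eq_right (show 1 ≤ iterLog 1 (b : ℝ) from hb)]
      rw [← h2, ← Real.exp_add, hsplit]
      congr 1; ring
    have hge : ∀ j, J < j → 0 ≤ β j := by
      intro j hj
      simp only [hβ, if_neg (show j ≠ 1 by omega), sub_zero]
      exact coeff_nonneg ha j
    refine ⟨fun hs => ?_, fun hgt => ?_⟩
    · by_contra hle
      have hlt : β J < 1 := lt_of_le_of_ne (not_lt.1 hle) hne
      refine not_summable_exp_neg_sumLog (J + 1) (summable_of_eventually_le hs (C := 1)
        (.of_forall fun _ => (Real.exp_pos _).le) ?_)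
      filter_upwards [hexp, hcast.eventually (eventually_le_sumLog hJn h1 hlt)] with b h2 h3
      have h4 : iterLog 1 b ≤ rate n a b := by
        have := Finset.single_le_sum (f := fun j => coeff n a j * iterLog (j + 1) (b : ℝ))
          (fun j _ => mul_nonneg (coeff_nonneg ha j) (iterLog_succ_nonneg _ _))
          (Finset.mem_range.2 (show 0 < n by omega))
        rw [rate]
        simpa [h0] using this
      calc Real.exp (-sumLog (J + 1) b)
          ≤ Real.exp (-∑ j ∈ Finset.range n, β j * iterLog (j + 1) b) :=
            Real.exp_le_exp.2 (neg_le_neg h3)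
        _ = Real.exp (-rate n a b) * iterLog 1 b := h2.symm
        _ ≤ Real.exp (-rate n a b) * rate n a b := by gcongr
        _ = _ := by ring
    · refine summable_of_eventually_le
        (summable_exp_neg_sumLog (J + 1) (sub_pos.2 hgt))
        (C := ∑ j ∈ Finset.range n, coeff n a j) hrate0 ?_
      filter_upwards [hexp] with b h2
      have h3 := rate_le ha (Nat.cast_nonneg (α := ℝ) b)
      have h4 := sumLog_add_le hJn h1 hge b
      have hC : 0 ≤ ∑ j ∈ Finset.range n, coeff n a j :=
        Finset.sum_nonneg fun j _ => coeff_nonneg ha j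
      calc rate n a b * Real.exp (-rate n a b)
          ≤ (∑ j ∈ Finset.range n, coeff n a j) * iterLog 1 b * Real.exp (-rate n a b) := by
            gcongr
        _ = (∑ j ∈ Finset.range n, coeff n a j) *
              Real.exp (-∑ j ∈ Finset.range n, β j * iterLog (j + 1) b) := by rw [← h2]; ring
        _ ≤ _ := by
            refine mul_le_mul_of_nonneg_left (Real.exp_le_exp.2 (neg_le_neg h4)) hC
  · have ha2 : 1 < a 2 := by simpa [coeff, hn] using h0
    refine iff_of_true ?_ (Or.inl ha2)
    set c := coeff n a 0
    -- The factor g is absorbed by g ≤ δ⁻¹ exp(δ g). This `δ` leaves (1 - δ) c = 1 + (c - 1) / 2,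
    -- still above 1.
    set δ := (c - 1) / (2 * c) with hδ
    have hδ0 : 0 < δ := div_pos (by linarith) (by linarith)
    refine summable_of_eventually_le
      (summable_exp_neg_sumLog 1 (show 0 < (c - 1) / 2 by linarith)) (C := δ⁻¹) hrate0 ?_
    filter_upwards [hrate1] with b h1
    have h2 : c * iterLog 1 b ≤ rate n a b :=
      Finset.single_le_sum (f := fun j => coeff n a j * iterLog (j + 1) (b : ℝ))
        (fun j _ => mul_nonneg (coeff_nonneg ha j) (iterLog_succ_nonneg _ _))
        (Finset.mem_range.2 (show 0 < n by omega))
    have h3 : (1 - δ) * c = 1 + (c - 1) / 2 := by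
      rw [hδ]; field_simp; ring
    have h4 : δ < 1 := by rw [hδ, div_lt_one (by linarith)]; linarith
    have h5 : sumLog 1 b + (c - 1) / 2 * iterLog 1 b ≤ (1 - δ) * rate n a b := by
      have : sumLog 1 b = iterLog 1 b := by simp [sumLog]
      rw [this]
      nlinarith
    have h6 : rate n a b ≤ δ⁻¹ * Real.exp (δ * rate n a b) := by
      rw [← div_eq_inv_mul, le_div_iff₀ hδ0]
      linarith [Real.add_one_le_exp (δ * rate n a b)]
    calc rate n a b * Real.exp (-rate n a b)
        ≤ δ⁻¹ * Real.exp (δ * rate n a b) * Real.exp (-rate n a b) := by gcongr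
      _ = δ⁻¹ * Real.exp (-((1 - δ) * rate n a b)) := by
          rw [mul_assoc, ← Real.exp_add]; congr 2; ring
      _ ≤ _ := by gcongr

end Criterion

/-! ### From the series to the presence or absence of gaps -/

section Dyadic

/-- The mass that `μ` gives to `(t, 2t]`, and to `(t, 2t + R]` for any `R`, is `g b + O(1)` for
`t` in the dyadic block `[2^b, 2^(b+1)]`, and `μ` has bounded density. -/
structure DyadicGrowth (μ : Measure ℝ) (g : ℕ → ℝ) : Prop where
  bounded : ∃ K : ℝ, ∀ s t : ℝ, s ≤ t → μ (Set.Ioc s t) ≤ ENNReal.ofReal (K * (t - s))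
  tendsto : Tendsto g atTop atTop
  lower : ∃ C : ℝ, ∀ᶠ b : ℕ in atTop, ∀ t ∈ Set.Icc ((2 : ℝ) ^ b) (2 ^ (b + 1)),
    g b - C ≤ μ.real (Set.Ioc t (2 * t))
  upper : ∀ R : ℕ, ∃ C : ℝ, ∀ᶠ b : ℕ in atTop, ∀ t ∈ Set.Icc ((2 : ℝ) ^ b) (2 ^ (b + 1)),
    μ.real (Set.Ioc t (2 * t + R)) ≤ g b + C

variable {μ : Measure ℝ} {g : ℕ → ℝ}

namespace DyadicGrowth

lemma measure_Ioc_ne_top (hμ : DyadicGrowth μ g) (s t : ℝ) : μ (Set.Ioc s t) ≠ ∞ := by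
  obtain ⟨K, hK⟩ := hμ.bounded
  rcases le_total s t with h | h
  · exact ((hK s t h).trans_lt ENNReal.ofReal_lt_top).ne
  · simp [Set.Ioc_eq_empty_of_le h]

lemma measure_Icc_ne_top (hμ : DyadicGrowth μ g) (s t : ℝ) : μ (Set.Icc s t) ≠ ∞ :=
  measure_ne_top_of_subset (fun x hx => ⟨by linarith [hx.1], hx.2⟩ : Set.Icc s t ⊆ Set.Ioc (s - 1) t)
    (hμ.measure_Ioc_ne_top _ _)

lemma measureReal_Ioc_add (hμ : DyadicGrowth μ g) {r s t : ℝ} (h1 : r ≤ s) (h2 : s ≤ t) :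
    μ.real (Set.Ioc r t) = μ.real (Set.Ioc r s) + μ.real (Set.Ioc s t) := by
  rw [← Set.Ioc_union_Ioc_eq_Ioc h1 h2]
  exact measureReal_union (Set.Ioc_disjoint_Ioc_of_le le_rfl) measurableSet_Ioc
    (hμ.measure_Ioc_ne_top _ _) (hμ.measure_Ioc_ne_top _ _)

lemma monotone_mass (hμ : DyadicGrowth μ g) : Monotone fun t => μ.real (Set.Ioc 0 t) :=
  fun _ _ h => measureReal_mono (Set.Ioc_subset_Ioc_right h) (hμ.measure_Ioc_ne_top _ _)

lemma tendsto_mass (hμ : DyadicGrowth μ g) :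
    Tendsto (fun t => μ.real (Set.Ioc 0 t)) atTop atTop := by
  refine tendsto_atTop_atTop_of_monotone hμ.monotone_mass fun x => ?_
  obtain ⟨C, hC⟩ := hμ.lower
  obtain ⟨b, h1, h2⟩ := (hC.and (hμ.tendsto.eventually_ge_atTop (x + C))).exists
  refine ⟨2 * 2 ^ b, ?_⟩
  have h3 := h1 (2 ^ b) ⟨le_rfl, pow_le_pow_right₀ one_le_two (by omega)⟩
  have h4 := hμ.measureReal_Ioc_add (r := 0) (s := 2 ^ b) (t := 2 * 2 ^ b) (by positivity)
    (by linarith [pow_pos (two_pos : (0 : ℝ) < 2) b])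
  have h5 := measureReal_nonneg (μ := μ) (s := Set.Ioc 0 (2 ^ b))
  linarith

lemma measure_univ_eq_top (hμ : DyadicGrowth μ g) : μ Set.univ = ∞ := by
  by_contra h
  obtain ⟨t, ht⟩ := (hμ.tendsto_mass.eventually_gt_atTop (μ.real Set.univ)).exists
  exact absurd (measureReal_mono (Set.subset_univ _) h) (not_le.2 ht)

/-- Bounded density makes the mass Lipschitz, so the intermediate value theorem can cut cells of
mass exactly one. -/
lemma continuousOn_mass (hμ : DyadicGrowth μ g) :
    ContinuousOn (fun t => μ.real (Set.Ioc 0 t)) (Set.Ici 0) := by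
  obtain ⟨K, hK⟩ := hμ.bounded
  have key : ∀ s t, 0 ≤ s → s ≤ t →
      |μ.real (Set.Ioc 0 s) - μ.real (Set.Ioc 0 t)| ≤ |K| * |s - t| := by
    intro s t hs hst
    rw [hμ.measureReal_Ioc_add hs hst, sub_add_cancel_left, abs_neg,
      abs_of_nonneg measureReal_nonneg, abs_sub_comm, abs_of_nonneg (sub_nonneg.2 hst)]
    refine ENNReal.toReal_le_of_le_ofReal (by have := sub_nonneg.2 hst; positivity) ?_
    refine (hK s t hst).trans (ENNReal.ofReal_le_ofReal ?_)
    exact mul_le_mul_of_nonneg_right (le_abs_self K) (sub_nonneg.2 hst)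
  refine (LipschitzOnWith.of_dist_le_mul (K := ‖K‖₊) fun s hs t ht => ?_).continuousOn
  rw [Real.dist_eq, Real.dist_eq, coe_nnnorm, Real.norm_eq_abs]
  rcases le_total s t with h | h
  · exact key s t hs h
  · rw [abs_sub_comm, abs_sub_comm s t]; exact key t s ht h

/-- Points cutting the half-line into cells of unit mass. -/
lemma exists_cells (hμ : DyadicGrowth μ g) :
    ∃ c : ℕ → ℝ, ∀ k, 0 ≤ c k ∧ μ.real (Set.Ioc 0 (c k)) = k := by
  have h : ∀ k : ℕ, ∃ t : ℝ, 0 ≤ t ∧ μ.real (Set.Ioc 0 t) = k := by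
    intro k
    obtain ⟨T, hT0, hT⟩ :=
      ((eventually_ge_atTop 0).and (hμ.tendsto_mass.eventually_ge_atTop (k : ℝ))).exists
    obtain ⟨t, ht, he⟩ := intermediate_value_Icc hT0
      (hμ.continuousOn_mass.mono (Set.Icc_subset_Ici_self)) (show (k : ℝ) ∈ _ from ⟨by simp, hT⟩)
    exact ⟨t, ht.1, he⟩
  choose c hc using h
  exact ⟨c, hc⟩

variable {c : ℕ → ℝ}

lemma strictMono_cells (hμ : DyadicGrowth μ g) (hc : ∀ k, 0 ≤ c k ∧ μ.real (Set.Ioc 0 (c k)) = k) :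
    StrictMono c := by
  intro i j hij
  by_contra! h
  have := hμ.monotone_mass h
  simp only [(hc _).2] at this
  exact absurd (Nat.cast_le.1 this) (by omega)

lemma tendsto_cells (hμ : DyadicGrowth μ g) (hc : ∀ k, 0 ≤ c k ∧ μ.real (Set.Ioc 0 (c k)) = k) :
    Tendsto c atTop atTop := by
  refine tendsto_atTop_atTop_of_monotone (hμ.strictMono_cells hc).monotone fun T => ?_
  obtain ⟨k, hk⟩ := exists_nat_gt (μ.real (Set.Ioc 0 T))
  refine ⟨k, ?_⟩
  by_contra! h
  have := hμ.monotone_mass h.le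
  simp only [(hc _).2] at this
  linarith

lemma measureReal_cells (hμ : DyadicGrowth μ g)
    (hc : ∀ k, 0 ≤ c k ∧ μ.real (Set.Ioc 0 (c k)) = k) {i j : ℕ} (hij : i ≤ j) :
    μ.real (Set.Ioc (c i) (c j)) = j - i := by
  have := hμ.measureReal_Ioc_add (hc i).1 ((hμ.strictMono_cells hc).monotone hij)
  rw [(hc i).2, (hc j).2] at this
  linarith

variable {Ω : Type*} [MeasurableSpace Ω] {P : Measure Ω} [IsProbabilityMeasure P] {X : Ω → Set ℝ}

/-- The hit is discarded; the empty set has mass at least that of (c k, 2 c k] minus one cell, which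
costs the factor e. -/
lemma measureReal_hitMiss_le (hμ : DyadicGrowth μ g) (hX : IsPoissonProcess P X μ)
    (hc : ∀ k, 0 ≤ c k ∧ μ.real (Set.Ioc 0 (c k)) = k) (k : ℕ) :
    P.real (hitMiss X (Set.Ioc (c k) (c (k + 1))) (Set.Ioc (c (k + 1)) (2 * c k)))
      ≤ Real.exp (1 - μ.real (Set.Ioc (c k) (2 * c k))) := by
  have h1 : P.real (hitMiss X (Set.Ioc (c k) (c (k + 1))) (Set.Ioc (c (k + 1)) (2 * c k)))
      ≤ P.real {ω | count X (Set.Ioc (c (k + 1)) (2 * c k)) ω = 0} :=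
    measureReal_mono fun ω hω => hω.2
  refine h1.trans ?_
  rw [measureReal_count_eq_zero hX measurableSet_Ioc (hμ.measure_Ioc_ne_top _ _)]
  refine Real.exp_le_exp.2 ?_
  have h2 : μ.real (Set.Ioc (c k) (2 * c k)) ≤
      μ.real (Set.Ioc (c k) (c (k + 1)) ∪ Set.Ioc (c (k + 1)) (2 * c k)) := by
    refine measureReal_mono Set.Ioc_subset_Ioc_union_Ioc ?_
    exact (measure_union_lt_top (hμ.measure_Ioc_ne_top _ _).lt_top
      (hμ.measure_Ioc_ne_top _ _).lt_top).ne
  have h3 := measureReal_union_le (μ := μ) (Set.Ioc (c k) (c (k + 1)))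
    (Set.Ioc (c (k + 1)) (2 * c k))
  rw [hμ.measureReal_cells hc (Nat.le_succ k)] at h3
  push_cast at h3
  linarith

lemma card_le_of_bounds {s : Finset ℕ} {α β : ℝ} (hαβ : α ≤ β)
    (h : ∀ k ∈ s, α ≤ k ∧ (k : ℝ) ≤ β) : (s.card : ℝ) ≤ β - α + 1 := by
  rcases s.eq_empty_or_nonempty with rfl | hne
  · simp; linarith
  · have h1 : s ⊆ Finset.Icc (s.min' hne) (s.max' hne) := fun k hk =>
      Finset.mem_Icc.2 ⟨s.min'_le k hk, s.le_max' k hk⟩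
    have h2 := Finset.card_le_card h1
    have h3 := (h _ (s.min'_mem hne)).1
    have h4 := (h _ (s.max'_mem hne)).2
    have h5 : s.min' hne ≤ s.max' hne := s.min'_le _ (s.max'_mem hne)
    rw [Nat.card_Icc] at h2
    have h6 : (s.card : ℝ) ≤ ((s.max' hne + 1 - s.min' hne : ℕ) : ℝ) := Nat.cast_le.2 h2
    rw [Nat.cast_sub (by omega)] at h6
    push_cast at h6
    linarith

/-- If `∑ g e^{-g}` converges, then all far away points `x` have another point in `(x, 2x]`. -/
lemma ae_close (hμ : DyadicGrowth μ g) (hX : IsPoissonProcess P X μ)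
    (hs : Summable fun b => g b * Real.exp (-g b)) :
    ∀ᵐ ω ∂P, ∃ T, ∀ x ∈ X ω, T < x → (X ω ∩ Set.Ioc x (2 * x)).Nonempty := by
  classical
  obtain ⟨c, hc⟩ := hμ.exists_cells
  have hmono := hμ.strictMono_cells hc
  obtain ⟨C, hC⟩ := hμ.lower
  obtain ⟨C', hC'⟩ := hμ.upper 0
  let A : ℕ → Set Ω := fun k =>
    hitMiss X (Set.Ioc (c k) (c (k + 1))) (Set.Ioc (c (k + 1)) (2 * c k))
  -- Cells with left end in block b; the range only serves finiteness, since `c k` has mass `k` to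
  -- its left.
  let F : ℕ → Finset ℕ := fun b =>
    (Finset.range (⌊μ.real (Set.Ioc 0 (2 ^ (b + 1)))⌋₊ + 1)).filter
      fun k => c k ∈ Set.Ico ((2 : ℝ) ^ b) (2 ^ (b + 1))
  let B : ℕ → Set Ω := fun b => ⋃ k ∈ F b, A k
  have hcard : ∀ b, ((F b).card : ℝ) ≤ μ.real (Set.Ioc (2 ^ b) (2 * 2 ^ b)) + 1 := by
    intro b
    have hadd := hμ.measureReal_Ioc_add (r := 0) (s := 2 ^ b) (t := 2 ^ (b + 1)) (by positivity)
      (pow_le_pow_right₀ one_le_two (by omega))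
    have h := card_le_of_bounds (s := F b)
      (hμ.monotone_mass (pow_le_pow_right₀ one_le_two (Nat.le_succ b)))
      (fun k hk => by
        obtain ⟨h1, h2⟩ := (Finset.mem_filter.1 hk).2
        have h3 := hμ.monotone_mass h1
        have h4 := hμ.monotone_mass h2.le
        simp only [(hc k).2] at h3 h4
        exact ⟨h3, h4⟩)
    rw [pow_succ'] at hadd h
    linarith
  have hB : ∀ᶠ b in atTop, P.real (B b) ≤
      (2 * Real.exp (1 + C)) * (g b * Real.exp (-g b)) := by
    filter_upwards [hC, hC', hμ.tendsto.eventually_ge_atTop (C' + 1)] with b h1 h2 h3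
    have h4 := h2 (2 ^ b) ⟨le_rfl, pow_le_pow_right₀ one_le_two (by omega)⟩
    rw [Nat.cast_zero, add_zero] at h4
    have h5 : ((F b).card : ℝ) ≤ 2 * g b := by linarith [hcard b]
    calc P.real (B b) ≤ ∑ k ∈ F b, P.real (A k) := measureReal_biUnion_finset_le _ _
      _ ≤ ∑ k ∈ F b, Real.exp (1 + C - g b) := by
          refine Finset.sum_le_sum fun k hk => ?_
          obtain ⟨h6, h7⟩ := (Finset.mem_filter.1 hk).2
          refine (hμ.measureReal_hitMiss_le hX hc k).trans (Real.exp_le_exp.2 ?_)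
          linarith [h1 (c k) ⟨h6, h7.le⟩]
      _ = (F b).card * Real.exp (1 + C - g b) := by rw [Finset.sum_const, nsmul_eq_mul]
      _ ≤ (2 * g b) * Real.exp (1 + C - g b) := by gcongr
      _ = _ := by rw [sub_eq_add_neg, Real.exp_add]; ring
  have hsum : Summable fun b => P.real (B b) :=
    summable_of_eventually_le hs (.of_forall fun _ => measureReal_nonneg) hB
  have hne : ∑' b, P (B b) ≠ ∞ := by
    simpa [measureReal_def, ENNReal.ofReal_toReal] using hsum.tsum_ofReal_ne_top
  filter_upwards [ae_eventually_notMem hne] with ω hω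
  obtain ⟨b₀, hb₀⟩ := eventually_atTop.1 hω
  obtain ⟨k₀, hk₀⟩ := ((hμ.tendsto_cells hc).eventually_ge_atTop (2 ^ b₀)).exists
  refine ⟨c k₀, fun x hx hxk => ?_⟩
  have hex : ∃ k, x ≤ c k := ((hμ.tendsto_cells hc).eventually_ge_atTop x).exists
  have hk := Nat.find_spec hex
  have hmin := fun j => Nat.find_min (m := j) hex
  set k' := Nat.find hex
  have hk0' : k₀ < k' := hmono.lt_iff_lt.1 (hxk.trans_le hk)
  obtain ⟨k, hkk⟩ : ∃ k, k' = k + 1 := ⟨k' - 1, by omega⟩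
  rw [hkk] at hk
  have hkx : c k < x := not_le.1 (hmin k (by omega))
  have hck : 2 ^ b₀ ≤ c k := hk₀.trans (hmono.monotone (by omega))
  obtain ⟨b, hb1, hb2⟩ := exists_nat_pow_near
    ((one_le_pow₀ one_le_two).trans hck : 1 ≤ c k) (one_lt_two : (1 : ℝ) < 2)
  have hbb : b₀ ≤ b := by
    have := (pow_lt_pow_iff_right₀ (one_lt_two : (1 : ℝ) < 2)).1 (hck.trans_lt hb2)
    omega
  have hkF : k ∈ F b := by
    refine Finset.mem_filter.2 ⟨Finset.mem_range_succ_iff.2 (Nat.le_floor ?_), hb1, hb2⟩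
    rw [← (hc k).2]
    exact hμ.monotone_mass hb2.le
  have hnot : ω ∉ A k := fun h => hb₀ b hbb (Set.mem_biUnion hkF h)
  have hhit : (X ω ∩ Set.Ioc (c k) (c (k + 1))).Nonempty := ⟨x, hx, hkx, hk⟩
  -- As x lies in cell k, the interval (c (k + 1), 2 c k] is contained in (x, 2x].
  have : (X ω ∩ Set.Ioc (c (k + 1)) (2 * c k)).Nonempty := by
    by_contra h
    exact hnot (mem_hitMiss.2 ⟨hhit, Set.not_nonempty_iff_eq_empty.1 h⟩)
  obtain ⟨z, hz, hz1, hz2⟩ := this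
  exact ⟨z, hz, lt_of_le_of_lt hk hz1, by linarith⟩

/-- If a series over the cells is summable, so is the series of its sums over dyadic blocks. -/
lemma summable_block_sums {u : ℕ → ℝ} (hu : Summable u) (hu0 : ∀ k, 0 ≤ u k) {F : ℕ → Finset ℕ}
    (hF : Pairwise fun b b' => Disjoint (F b) (F b')) :
    Summable fun b => ∑ k ∈ F b, u k := by
  refine summable_of_sum_range_le (c := ∑' k, u k)
    (fun b => Finset.sum_nonneg fun k _ => hu0 k) fun n => ?_
  rw [← Finset.sum_biUnion fun b _ b' _ hbb' => hF hbb']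
  exact hu.sum_le_tsum _ fun k _ => hu0 k

/-- If `∑ g e^{-g}` diverges, then arbitrarily far there are points `x` with no other point in
`(x, 2x + R]`. -/
lemma ae_gaps (hμ : DyadicGrowth μ g) (hX : IsPoissonProcess P X μ)
    (hs : ¬ Summable fun b => g b * Real.exp (-g b)) (R : ℕ) :
    ∀ᵐ ω ∂P, ∀ T : ℝ, ∃ x ∈ X ω, T < x ∧ X ω ∩ Set.Ioc x (2 * x + R) = ∅ := by
  classical
  obtain ⟨c, hc⟩ := hμ.exists_cells
  have hmono := hμ.strictMono_cells hc
  have htend := hμ.tendsto_cells hc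
  obtain ⟨C, hC⟩ := hμ.lower
  obtain ⟨C', hC'⟩ := hμ.upper R
  have hex : ∀ k, ∃ m, 2 * c (k + 1) + R ≤ c m := fun k =>
    (htend.eventually_ge_atTop (2 * c (k + 1) + R)).exists
  -- The window to be emptied is rounded up to a whole number of cells; minimality of `m` limits the
  -- excess mass to one.
  have hm : ∀ k, ∃ m, k + 1 ≤ m ∧ 2 * c (k + 1) + R ≤ c m ∧
      (m : ℝ) ≤ μ.real (Set.Ioc 0 (2 * c (k + 1) + R)) + 1 := by
    intro k
    have h1 := Nat.find_spec (hex k)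
    have h2 := fun j => Nat.find_min (m := j) (hex k)
    have h0 := (hc (k + 1)).1
    set m := Nat.find (hex k)
    refine ⟨m, hmono.le_iff_le.1 (by linarith [(Nat.cast_nonneg R : (0 : ℝ) ≤ R)]), h1, ?_⟩
    rcases Nat.eq_zero_or_pos m with h | h
    · rw [h, Nat.cast_zero]; positivity
    · obtain ⟨j, hj⟩ : ∃ j, m = j + 1 := ⟨m - 1, by omega⟩
      have h3 := hμ.monotone_mass (not_le.1 (h2 j (by omega))).le
      simp only [(hc _).2] at h3
      rw [hj]; push_cast; linarith
  choose m hm1 hm2 hm3 using hm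
  let A : ℕ → Set Ω := fun k =>
    hitMiss X (Set.Ioc (c k) (c (k + 1))) (Set.Ioc (c (k + 1)) (c (m k)))
  have hA : ∀ k, MeasurableSet (A k) := fun k =>
    measurableSet_hitMiss hX measurableSet_Ioc measurableSet_Ioc
  have hPA : ∀ k, P.real (A k) = (1 - Real.exp (-1)) * Real.exp (-(m k - (k + 1))) := by
    intro k
    rw [measureReal_hitMiss hX measurableSet_Ioc measurableSet_Ioc
      (Set.Ioc_disjoint_Ioc_of_le le_rfl) (hμ.measure_Ioc_ne_top _ _)
      (hμ.measure_Ioc_ne_top _ _), hμ.measureReal_cells hc (Nat.le_succ k),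
      hμ.measureReal_cells hc (hm1 k)]
    push_cast
    congr 3
    ring
  have hcorr : ∀ i j, i < j → P.real (A i ∩ A j) ≤ P.real (A i) * P.real (A j) := by
    intro i j hij
    -- Either cell j lies in the window that event i requires to be empty, and the events are
    -- incompatible, or all sets involved are disjoint and the events are independent.
    rcases Nat.lt_or_ge j (m i) with h | h
    · have : A i ∩ A j = ∅ := by
        refine Set.eq_empty_of_forall_notMem fun ω ⟨h1, h2⟩ => ?_
        obtain ⟨x, hx, hx1, hx2⟩ := (mem_hitMiss.1 h2).1
        have : x ∈ X ω ∩ Set.Ioc (c (i + 1)) (c (m i)) :=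
          ⟨hx, (hmono.monotone hij).trans_lt hx1, hx2.trans (hmono.monotone h)⟩
        rw [(mem_hitMiss.1 h1).2] at this
        exact this
      rw [this, measureReal_empty]
      exact mul_nonneg measureReal_nonneg measureReal_nonneg
    · have hd : ∀ {p q r s : ℕ}, q ≤ r → Disjoint (Set.Ioc (c p) (c q)) (Set.Ioc (c r) (c s)) :=
        fun h => Set.Ioc_disjoint_Ioc_of_le (hmono.monotone h)
      rw [measureReal_def, measureReal_def, measureReal_def, ← ENNReal.toReal_mul]
      exact (congrArg ENNReal.toReal (measure_hitMiss_inter hX measurableSet_Ioc measurableSet_Ioc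
        measurableSet_Ioc measurableSet_Ioc (hd le_rfl) (hd hij) (hd (by omega)) (hd h)
        (hd (by omega)) (hd le_rfl))).le
  have hdiv : ¬ Summable fun k => P.real (A k) := by
    intro hsum
    -- Here the right ends `c (k + 1)` lie in the block, because the upper mass bound is applied
    -- there; floor and ceiling keep them strictly inside.
    let F : ℕ → Finset ℕ := fun b =>
      Finset.Ico ⌊μ.real (Set.Ioc 0 (2 ^ b))⌋₊ (⌈μ.real (Set.Ioc 0 (2 ^ (b + 1)))⌉₊ - 1)
    have hF : ∀ b, ∀ k ∈ F b, c (k + 1) ∈ Set.Ioo ((2 : ℝ) ^ b) (2 ^ (b + 1)) := by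
      intro b k hk
      obtain ⟨h1, h2⟩ := Finset.mem_Ico.1 hk
      constructor
      · by_contra! h
        have h3 := hμ.monotone_mass h
        simp only [(hc _).2] at h3
        have h4 := Nat.lt_of_floor_lt (Nat.lt_succ_of_le h1)
        push_cast at h3 h4
        linarith
      · by_contra! h
        have h3 := hμ.monotone_mass h
        simp only [(hc _).2] at h3
        have h4 : k + 1 < ⌈μ.real (Set.Ioc 0 ((2 : ℝ) ^ (b + 1)))⌉₊ := by omega
        have h5 := Nat.lt_ceil.1 h4
        linarith
    have hFd : Pairwise fun b b' => Disjoint (F b) (F b') := by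
      have key : ∀ b b', b < b' → Disjoint (F b) (F b') := by
        intro b b' hbb
        refine Finset.disjoint_left.2 fun k h1 h2 => ?_
        have h3 := (hF b k h1).2.trans (lt_of_le_of_lt
          (pow_le_pow_right₀ one_le_two (show b + 1 ≤ b' by omega)) (hF b' k h2).1)
        exact lt_irrefl _ h3
      intro b b' hbb
      rcases lt_or_gt_of_ne hbb with h | h
      · exact key b b' h
      · exact (key b' b h).symm
    have hcard : ∀ b, μ.real (Set.Ioc (2 ^ b) (2 * 2 ^ b)) - 1 ≤ ((F b).card : ℝ) := by
      intro b
      have hadd := hμ.measureReal_Ioc_add (r := 0) (s := 2 ^ b) (t := 2 ^ (b + 1)) (by positivity)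
        (pow_le_pow_right₀ one_le_two (by omega))
      rw [Nat.card_Ico]
      have h1 := Nat.floor_le (measureReal_nonneg (μ := μ) (s := Set.Ioc 0 ((2 : ℝ) ^ b)))
      have h2 := Nat.le_ceil (μ.real (Set.Ioc 0 ((2 : ℝ) ^ (b + 1))))
      have h3 : ⌈μ.real (Set.Ioc 0 ((2 : ℝ) ^ (b + 1)))⌉₊ ≤
          (⌈μ.real (Set.Ioc 0 ((2 : ℝ) ^ (b + 1)))⌉₊ - 1 - ⌊μ.real (Set.Ioc 0 ((2 : ℝ) ^ b))⌋₊)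
            + 1 + ⌊μ.real (Set.Ioc 0 ((2 : ℝ) ^ b))⌋₊ := by omega
      have h4 := (Nat.cast_le (α := ℝ)).2 h3
      rw [Nat.cast_add, Nat.cast_add, Nat.cast_one] at h4
      rw [← pow_succ']
      linarith
    have hsum' := summable_block_sums hsum (fun _ => measureReal_nonneg) hFd
    have he : 0 < 1 - Real.exp (-1) := sub_pos.2 (by simp)
    refine hs (summable_of_eventually_le hsum'
      (C := 2 * ((1 - Real.exp (-1)) * Real.exp (-(C' + 1)))⁻¹) ?_ ?_)
    · filter_upwards [hμ.tendsto.eventually_ge_atTop 0] with b hb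
      exact mul_nonneg hb (Real.exp_pos _).le
    filter_upwards [hC, hC', hμ.tendsto.eventually_ge_atTop (2 * (C + 1))] with b h1 h2 h3
    have h4 := h1 (2 ^ b) ⟨le_rfl, pow_le_pow_right₀ one_le_two (by omega)⟩
    have h5 : g b / 2 ≤ (F b).card := by linarith [hcard b]
    have h6 : g b / 2 * ((1 - Real.exp (-1)) * (Real.exp (-(C' + 1)) * Real.exp (-g b)))
        ≤ ∑ k ∈ F b, P.real (A k) := by
      calc _ ≤ ((F b).card : ℝ) *
            ((1 - Real.exp (-1)) * (Real.exp (-(C' + 1)) * Real.exp (-g b))) := by gcongr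
        _ = ∑ k ∈ F b, (1 - Real.exp (-1)) * (Real.exp (-(C' + 1)) * Real.exp (-g b)) := by
            rw [Finset.sum_const, nsmul_eq_mul]
        _ ≤ _ := by
            refine Finset.sum_le_sum fun k hk => ?_
            rw [hPA, ← Real.exp_add]
            refine mul_le_mul_of_nonneg_left (Real.exp_le_exp.2 ?_) he.le
            have h7 := hF b k hk
            have h8 := h2 _ ⟨h7.1.le, h7.2.le⟩
            have h9 := hμ.measureReal_Ioc_add (hc (k + 1)).1
              (show c (k + 1) ≤ 2 * c (k + 1) + R by
                linarith [(hc (k + 1)).1, (Nat.cast_nonneg R : (0 : ℝ) ≤ R)])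
            rw [(hc (k + 1)).2] at h9
            push_cast at h9
            linarith [hm3 k]
    have h7 : 0 < (1 - Real.exp (-1)) * Real.exp (-(C' + 1)) := mul_pos he (Real.exp_pos _)
    rw [mul_assoc, ← div_eq_inv_mul, ← mul_div_assoc, le_div_iff₀ h7]
    linarith
  filter_upwards [ae_frequently_of_negCorr hA hcorr hdiv,
    ae_locFinite hX hμ.measure_Icc_ne_top] with ω hω hfin T
  obtain ⟨k, hk, hkT⟩ := (hω.and_eventually (htend.eventually_gt_atTop T)).exists
  obtain ⟨hne, hemp⟩ := mem_hitMiss.1 hk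
  have hfinc : (X ω ∩ Set.Ioc (c k) (c (k + 1))).Finite := by
    refine (hfin (c (k + 1))).subset (Set.inter_subset_inter_right _ fun y hy => ⟨?_, hy.2⟩)
    linarith [(hc k).1, (hc (k + 1)).1, hy.1]
  -- The rightmost point of the cell has nothing after it in the cell or in the empty window.
  obtain ⟨x, ⟨hx, hx1, hx2⟩, hmax⟩ := Set.exists_max_image _ id hfinc hne
  refine ⟨x, hx, hkT.trans hx1, Set.eq_empty_of_forall_notMem fun z ⟨hz, hz1, hz2⟩ => ?_⟩
  rcases le_or_gt z (c (k + 1)) with h | h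
  · exact absurd (hmax z ⟨hz, hx1.trans hz1, h⟩) (not_le.2 hz1)
  · have : z ∈ X ω ∩ Set.Ioc (c (k + 1)) (c (m k)) := ⟨hz, h, by linarith [hm2 k]⟩
    rw [hemp] at this
    exact this

end DyadicGrowth

end Dyadic

/-! ### Dyadic growth of the given intensity -/

section Intensity

variable {n : ℕ} {a : ℕ → ℝ}

lemma intensity_eq (hn : 2 ≤ n) (t : ℝ) :
    intensity n a t = rate n a (truncLog |t|) / (|t| * Real.log 2) := by
  have h : ∑ i ∈ Finset.Icc 2 n, a i * iterLog i |t| = rate n a (truncLog |t|) := by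
    have e : n = n - 1 + 1 := by omega
    rw [rate, e, Finset.sum_range_succ, ← e, coeff, if_neg (by omega), zero_mul, add_zero,
      ← Finset.Ico_add_one_right_eq_Icc, Finset.sum_Ico_eq_sum_range]
    refine Finset.sum_congr (by congr 1) fun j hj => ?_
    rw [coeff, if_pos (by have := Finset.mem_range.1 hj; omega), ← iterLog_succ', add_comm 2 j]
  rw [intensity, h, one_div_mul_eq_div]

lemma monotone_rate (ha : ∀ i, 2 ≤ i → i ≤ n → 0 ≤ a i) : Monotone (rate n a) := fun _ _ h =>
  Finset.sum_le_sum fun j _ =>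
    mul_le_mul_of_nonneg_left (monotone_iterLog _ h) (coeff_nonneg ha j)

lemma rate_nonneg (ha : ∀ i, 2 ≤ i → i ≤ n → 0 ≤ a i) (t : ℝ) : 0 ≤ rate n a t :=
  Finset.sum_nonneg fun j _ => mul_nonneg (coeff_nonneg ha j) (iterLog_succ_nonneg _ _)

lemma sum_coeff_nonneg (ha : ∀ i, 2 ≤ i → i ≤ n → 0 ≤ a i) :
    0 ≤ ∑ j ∈ Finset.range n, coeff n a j := Finset.sum_nonneg fun j _ => coeff_nonneg ha j

lemma rate_le_mul (ha : ∀ i, 2 ≤ i → i ≤ n → 0 ≤ a i) {t : ℝ} (ht : 0 ≤ t) :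
    rate n a t ≤ (∑ j ∈ Finset.range n, coeff n a j) * t :=
  (rate_le ha ht).trans (mul_le_mul_of_nonneg_left (truncLog_le ht) (sum_coeff_nonneg ha))

/-- Doubling t raises `truncLog t` by at most 1, and further logarithms do not enlarge increments.
-/
lemma rate_two_mul_le (ha : ∀ i, 2 ≤ i → i ≤ n → 0 ≤ a i) {t : ℝ} (ht : 0 ≤ t) :
    rate n a (2 * t) ≤ rate n a t + ∑ j ∈ Finset.range n, coeff n a j := by
  rw [rate, rate, ← Finset.sum_add_distrib]
  refine Finset.sum_le_sum fun j _ => ?_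
  have h1 : t ≤ 2 * t := by linarith
  have h2 := truncLog_sub_le h1
  have h3 : (2 * t - t) * Real.exp (-truncLog t) ≤ 1 := by
    rw [Real.exp_neg, exp_truncLog, ← div_eq_mul_inv,
      div_le_one (lt_of_lt_of_le one_pos (le_max_left _ _))]
    linarith [le_max_right 1 t]
  have h4 := iterLog_sub_le_sub j (monotone_truncLog h1)
  rw [← iterLog_succ', ← iterLog_succ'] at h4
  nlinarith [coeff_nonneg ha j]

/-- For b ≥ 3, log s lies between b / 2 and 2b, so the doubling bound applies on both sides. The
exponent b + 3 leaves room for 2t + R with t in block b and R ≤ 2^b. -/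
lemma rate_truncLog_bounds (ha : ∀ i, 2 ≤ i → i ≤ n → 0 ≤ a i) {b : ℕ} (hb : 3 ≤ b) {s : ℝ}
    (h1 : (2 : ℝ) ^ b ≤ s) (h2 : s ≤ 2 ^ (b + 3)) :
    rate n a b - ∑ j ∈ Finset.range n, coeff n a j ≤ rate n a (truncLog s) ∧
      rate n a (truncLog s) ≤ rate n a b + ∑ j ∈ Finset.range n, coeff n a j := by
  have hpow : (0 : ℝ) < 2 ^ b := by positivity
  have hs1 : 1 < s := lt_of_lt_of_le (one_lt_pow₀ one_lt_two (by omega)) h1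
  have hlow := Real.log_le_log hpow h1
  have hup := Real.log_le_log (by linarith) h2
  rw [Real.log_pow] at hlow hup
  have hl1 := Real.log_two_gt_d9
  have hl2 := Real.log_two_lt_d9
  have hb' : (3 : ℝ) ≤ b := by exact_mod_cast hb
  push_cast at hup
  rw [truncLog, if_pos hs1]
  constructor
  · have h3 : (b : ℝ) ≤ 2 * Real.log s := by nlinarith
    have := (monotone_rate ha h3).trans (rate_two_mul_le ha (Real.log_nonneg hs1.le))
    linarith
  · have h3 : Real.log s ≤ 2 * b := by nlinarith
    exact (monotone_rate ha h3).trans (rate_two_mul_le ha (by positivity))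

lemma setLIntegral_div {k t u : ℝ} (hk : 0 ≤ k) (ht : 0 < t) (htu : t ≤ u) :
    ∫⁻ s in Set.Ioc t u, ENNReal.ofReal (k / s) = ENNReal.ofReal (k * Real.log (u / t)) := by
  have hint : IntervalIntegrable (fun s : ℝ => k / s) volume t u := by
    refine ContinuousOn.intervalIntegrable fun s hs => ContinuousAt.continuousWithinAt ?_
    rw [Set.uIcc_of_le htu] at hs
    exact continuousAt_const.div continuousAt_id (ht.trans_le hs.1).ne'
  rw [← ofReal_integral_eq_lintegral_ofReal hint.1, ← intervalIntegral.integral_of_le htu]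
  · simp only [div_eq_mul_inv]
    rw [intervalIntegral.integral_const_mul, integral_inv_of_pos ht (ht.trans_le htu)]
    rfl
  · refine (ae_restrict_iff' measurableSet_Ioc).2 (ae_of_all _ fun s hs => ?_)
    exact div_nonneg hk (ht.trans hs.1).le

lemma meanMeasure_neg (l : ℝ → ℝ) (hl : ∀ t, l (-t) = l t) {A : Set ℝ} (hA : MeasurableSet A) :
    meanMeasure l (-A) = meanMeasure l A := by
  rw [meanMeasure, withDensity_apply _ hA.neg, withDensity_apply _ hA]
  have := (Measure.measurePreserving_neg (volume : Measure ℝ)).setLIntegral_comp_preimage_emb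
    (MeasurableEquiv.neg ℝ).measurableEmbedding (fun t => ENNReal.ofReal (l t)) A
  simp only [hl] at this
  exact this

lemma intensity_neg (t : ℝ) : intensity n a (-t) = intensity n a t := by
  simp [intensity]

/-- The integral of 1 / (s log 2) over (t, 2t] is 1, and the rate varies by O(1) there, so the mass
is the rate at b up to a constant. -/
lemma dyadicGrowth_intensity (hn : 2 ≤ n) (ha : ∀ i, 2 ≤ i → i ≤ n → 0 ≤ a i)
    (ha0 : ∃ i, 2 ≤ i ∧ i ≤ n ∧ a i ≠ 0) :
    DyadicGrowth (meanMeasure (intensity n a)) fun b => rate n a b := by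
  have hlog : 0 < Real.log 2 := Real.log_pos one_lt_two
  set C := ∑ j ∈ Finset.range n, coeff n a j with hC
  have hC0 : 0 ≤ C := sum_coeff_nonneg ha
  have htend : Tendsto (fun b : ℕ => rate n a b) atTop atTop :=
    (tendsto_rate ha ha0).comp tendsto_natCast_atTop_atTop
  have hbdd : ∀ s t : ℝ, s ≤ t →
      meanMeasure (intensity n a) (Set.Ioc s t) ≤ ENNReal.ofReal (C / Real.log 2 * (t - s)) := by
    intro s t hst
    rw [meanMeasure, withDensity_apply _ measurableSet_Ioc]
    calc ∫⁻ x in Set.Ioc s t, ENNReal.ofReal (intensity n a x)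
        ≤ ∫⁻ _ in Set.Ioc s t, ENNReal.ofReal (C / Real.log 2) := by
          refine lintegral_mono fun x => ENNReal.ofReal_le_ofReal ?_
          rw [intensity_eq hn]
          rcases eq_or_lt_of_le (abs_nonneg x) with h | h
          · rw [← h, zero_mul, div_zero]; positivity
          · rw [div_le_div_iff₀ (by positivity) hlog]
            have h1 := rate_le_mul ha (truncLog_nonneg |x|)
            have h2 := mul_le_mul_of_nonneg_left (truncLog_le h.le) hC0
            nlinarith
      _ = ENNReal.ofReal (C / Real.log 2 * (t - s)) := by
          rw [lintegral_const, Measure.restrict_apply_univ, Real.volume_Ioc,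
            ENNReal.ofReal_mul (by positivity)]
  have hfin : ∀ s t : ℝ, meanMeasure (intensity n a) (Set.Ioc s t) ≠ ∞ := by
    intro s t
    rcases le_total s t with h | h
    · exact ((hbdd s t h).trans_lt ENNReal.ofReal_lt_top).ne
    · simp [Set.Ioc_eq_empty_of_le h]
  refine ⟨⟨_, hbdd⟩, htend, ⟨C, ?_⟩, fun R => ⟨C + 2 * C * R, ?_⟩⟩
  · filter_upwards [eventually_ge_atTop 3, htend.eventually_ge_atTop C] with b hb hbC t ht
    have ht0 : 0 < t := lt_of_lt_of_le (by positivity) ht.1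
    have hle : ENNReal.ofReal ((rate n a b - C) / Real.log 2 * Real.log (2 * t / t)) ≤
        meanMeasure (intensity n a) (Set.Ioc t (2 * t)) := by
      rw [← setLIntegral_div (div_nonneg (by linarith) hlog.le) ht0 (by linarith), meanMeasure,
        withDensity_apply _ measurableSet_Ioc]
      refine setLIntegral_mono' measurableSet_Ioc fun s hs => ENNReal.ofReal_le_ofReal ?_
      have hs0 : 0 < s := ht0.trans hs.1
      have h3 : s ≤ 2 ^ (b + 3) := by
        have := ht.2
        have h4 := hs.2
        rw [pow_succ] at this ⊢
        rw [pow_succ, pow_succ]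
        linarith
      rw [intensity_eq hn, abs_of_pos hs0, div_div, mul_comm (Real.log 2)]
      have := (rate_truncLog_bounds ha hb (ht.1.trans hs.1.le) h3).1
      gcongr
    have h2 := (ENNReal.ofReal_le_iff_le_toReal (hfin _ _)).1 hle
    rwa [mul_div_cancel_right₀ _ ht0.ne', div_mul_cancel₀ _ hlog.ne'] at h2
  · have hpow : Tendsto (fun b : ℕ => (2 : ℝ) ^ b) atTop atTop :=
      tendsto_pow_atTop_atTop_of_one_lt one_lt_two
    filter_upwards [eventually_ge_atTop 3, hpow.eventually_ge_atTop (R : ℝ)] with b hb hbR t ht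
    have hR0 : (0 : ℝ) ≤ R := Nat.cast_nonneg R
    have hb0 : (0 : ℝ) < 2 ^ b := by positivity
    have ht0 : 0 < t := lt_of_lt_of_le hb0 ht.1
    have hr0 := rate_nonneg ha (b : ℝ)
    have hle : meanMeasure (intensity n a) (Set.Ioc t (2 * t + R)) ≤
        ENNReal.ofReal ((rate n a b + C) / Real.log 2 * Real.log ((2 * t + R) / t)) := by
      rw [← setLIntegral_div (div_nonneg (by linarith) hlog.le) ht0 (by linarith), meanMeasure,
        withDensity_apply _ measurableSet_Ioc]
      refine setLIntegral_mono' measurableSet_Ioc fun s hs => ENNReal.ofReal_le_ofReal ?_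
      have hs0 : 0 < s := ht0.trans hs.1
      have h3 : s ≤ 2 ^ (b + 3) := by
        have := ht.2
        have h4 := hs.2
        rw [pow_succ] at this ⊢
        rw [pow_succ, pow_succ]
        linarith
      rw [intensity_eq hn, abs_of_pos hs0, div_div, mul_comm (Real.log 2)]
      have := (rate_truncLog_bounds ha hb (ht.1.trans hs.1.le) h3).2
      gcongr
    have hlogle : Real.log ((2 * t + R) / t) ≤ Real.log 2 + R / (2 * t) := by
      have e : (2 * t + R) / t = 2 * (1 + R / (2 * t)) := by field_simp
      have hp : 0 < 1 + R / (2 * t) := by positivity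
      rw [e, Real.log_mul two_ne_zero hp.ne']
      linarith [Real.log_le_sub_one_of_pos hp]
    have hlogt : 0 ≤ Real.log ((2 * t + R) / t) :=
      Real.log_nonneg ((one_le_div ht0).2 (by linarith))
    refine (ENNReal.toReal_le_of_le_ofReal (by positivity) hle).trans ?_
    -- The extra length R contributes at most (g + C) R / 2^b, which this crude bound keeps bounded
    -- in b.
    have hrb : rate n a b + C ≤ 2 * C * 2 ^ b := by
      have h1 := rate_le_mul ha (Nat.cast_nonneg (α := ℝ) b)
      have h2 : (b : ℝ) ≤ 2 ^ b := by exact_mod_cast b.lt_two_pow_self.le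
      have h3 : (1 : ℝ) ≤ 2 ^ b := one_le_pow₀ one_le_two
      nlinarith
    have hl1 := Real.log_two_gt_d9
    have hRt : R / (2 * t) ≤ R / 2 ^ b * Real.log 2 := by
      rw [div_mul_eq_mul_div, div_le_div_iff₀ (by positivity) hb0]
      have h1 : (2 : ℝ) ^ b ≤ Real.log 2 * (2 * t) := by nlinarith [ht.1]
      rw [mul_assoc]
      exact mul_le_mul_of_nonneg_left h1 hR0
    calc (rate n a b + C) / Real.log 2 * Real.log ((2 * t + R) / t)
        ≤ (rate n a b + C) / Real.log 2 * (Real.log 2 + R / 2 ^ b * Real.log 2) := by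
          gcongr
          linarith
      _ = rate n a b + C + (rate n a b + C) * (R / 2 ^ b) := by field_simp
      _ ≤ rate n a b + C + 2 * C * 2 ^ b * (R / 2 ^ b) := by gcongr
      _ = rate n a b + (C + 2 * C * R) := by field_simp; ring

end Intensity

end GreedyWalk

theorem proposition2 {Ω : Type*} [MeasurableSpace Ω] (P : Measure Ω) [IsProbabilityMeasure P]
    (n : ℕ) (hn : 2 ≤ n) (a : ℕ → ℝ) (ha : ∀ i, 2 ≤ i → i ≤ n → 0 ≤ a i)
    (ha0 : ∃ i, 2 ≤ i ∧ i ≤ n ∧ a i ≠ 0)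
    (X : Ω → Set ℝ)
    (hX : GreedyWalk.IsPoissonProcess P X
      (GreedyWalk.meanMeasure (GreedyWalk.intensity n a))) :
    (GreedyWalk.TransienceCondition n a → ∀ᵐ ω ∂P, GreedyWalk.Transient (X ω)) ∧
    (¬ GreedyWalk.TransienceCondition n a → ∀ᵐ ω ∂P, GreedyWalk.Recurrent (X ω)) := by
  have hμ := GreedyWalk.dyadicGrowth_intensity hn ha ha0
  -- The intensity is even, so the reflected process has the same mean measure and both half-lines
  -- obey the same series.
  have hX' := hX.neg fun A hA => GreedyWalk.meanMeasure_neg _ GreedyWalk.intensity_neg hA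
  have hiff := GreedyWalk.summable_rate_iff hn ha ha0
  have hfin := GreedyWalk.ae_locFinite hX hμ.measure_Icc_ne_top
  have h0 := GreedyWalk.ae_inter_eq_empty hX (MeasurableSet.singleton 0)
    (withDensity_absolutelyContinuous _ _ (measure_singleton 0))
  have hinf := hX.law_top _ MeasurableSet.univ hμ.measure_univ_eq_top
  constructor
  · intro hT
    filter_upwards [hfin, h0, hinf, hμ.ae_close hX (hiff.2 hT),
      hμ.ae_close hX' (hiff.2 hT)] with ω h1 h2 h3 h4 h5
    refine GreedyWalk.transient_of_close h1 ?_ (by simpa using h2) h4 h5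
    rwa [GreedyWalk.count, Set.inter_univ, Set.encard_eq_top_iff] at h3
  · intro hT
    filter_upwards [hfin, h0, ae_all_iff.2 fun R => hμ.ae_gaps hX (fun h => hT (hiff.1 h)) R,
      ae_all_iff.2 fun R => hμ.ae_gaps hX' (fun h => hT (hiff.1 h)) R] with ω h1 h2 h4 h5
    exact GreedyWalk.recurrent_of_gaps h1 (by simpa using h2) h4 h5
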